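/- Lemma 2.4. Let $M$ be an oriented smooth $4$-manifold (without boundary), $g$ a smooth Riemannian metric on $M$ and $f\in C^\infty(M)$ such that $(M,g,f)$ is a gradient Ricci soliton, i.e. $\mathrm{Ric}+\nabla^2 f=\lambda g$ on $M$ for some constant $\lambda\in\mathbb{R}$ (of any sign). Let $$W_{ijkl}=R_{ijkl}-\tfrac12\,(R_{ik}g_{jl}+R_{jl}g_{ik}-R_{il}g_{jk}-R_{jk}g_{il})+\tfrac{R}{6}\,(g_{ik}g_{jl}-g_{il}g_{jk})$$ be the Weyl tensor, where $R_{ijkl}$, $R_{ij}$ and $R$ are the Riemann curvature tensor (with sign such that $R_{ijij}$ is the sectional curvature of an orthonormal pair $e_i,e_j$), the Ricci tensor and the scalar curvature, and let $$W^\pm_{ijkl}=\tfrac14\,(W_{ijkl}\pm W_{ijk'l'}\pm W_{i'j'kl}+W_{i'j'k'l'})$$ be its self-dual and anti-self-dual parts. Here indices refer to a positively oriented orthonormal frame and, for $i\ne j$, $(i'j')$ is the pair such that $(i\,j\,i'\,j')$ is an even permutation of $(1\,2\,3\,4)$; that is, replacing $ij$ by $i'j'$ is the action of the Hodge star on $2$-forms.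 Let $(\delta W^\pm)_{jkl}=\nabla^i W^\pm_{ijkl}$. If $\delta W^+=0$ on $M$ or $\delta W^-=0$ on $M$, then at every point $p\in M$ with $\nabla f(p)\neq 0$ the vector $\nabla f(p)$ is an eigenvector of the Ricci tensor, viewed as the endomorphism $R^i{}_k=g^{ij}R_{jk}$ of $T_pM$. -/

import Mathlib

open scoped Manifold ContDiff

noncomputable section

namespace HalfWeyl

/-- The model space `ℝ⁴`. -/
abbrev E4 : Type := EuclideanSpace ℝ (Fin 4)

/-! ## Tensor calculus in coordinates

`G` is the matrix `(g_ij)` of a metric as a function of the coordinates `u ∈ ℝ⁴`; only its values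
near the point of evaluation matter. Indices of tensor components are in the usual order. -/

/-- The partial derivative `∂_i F` at `u`. -/
def pd (i : Fin 4) (F : E4 → ℝ) (u : E4) : ℝ :=
  fderiv ℝ F u (EuclideanSpace.single i 1)

/-- The inverse metric `g^{ij}`. -/
def gInv (G : E4 → Matrix (Fin 4) (Fin 4) ℝ) (i j : Fin 4) (u : E4) : ℝ :=
  (G u)⁻¹ i j

/-- The Christoffel symbol `Γ^k_{ij} = ½ g^{kl} (∂_i g_jl + ∂_j g_il - ∂_l g_ij)` of the
Levi-Civita connection. -/
def Gam (G : E4 → Matrix (Fin 4) (Fin 4) ℝ) (k i j : Fin 4) (u : E4) : ℝ :=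
  (1 / 2) * ∑ l, gInv G k l u *
    (pd i (fun v => G v j l) u + pd j (fun v => G v i l) u - pd l (fun v => G v i j) u)

/-- The curvature components `R_{ijl}^h`, where `∇_i ∇_j ∂_l - ∇_j ∇_i ∂_l = R_{ijl}^h ∂_h`:
`R_{ijl}^h = ∂_i Γ^h_{jl} - ∂_j Γ^h_{il} + Γ^h_{ip} Γ^p_{jl} - Γ^h_{jp} Γ^p_{il}`. -/
def riemUp (G : E4 → Matrix (Fin 4) (Fin 4) ℝ) (h i j l : Fin 4) (u : E4) : ℝ :=
  pd i (Gam G h j l) u - pd j (Gam G h i l) u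
    + ∑ p, (Gam G h i p u * Gam G p j l u - Gam G h j p u * Gam G p i l u)

/-- `R_{ijkl} = g_{hk} R_{ijl}^h`; the sectional curvature of an orthonormal pair `e_i, e_j` is
`R_{ijij}`. -/
def riem (G : E4 → Matrix (Fin 4) (Fin 4) ℝ) (i j k l : Fin 4) (u : E4) : ℝ :=
  ∑ h, G u h k * riemUp G h i j l u

/-- The Ricci tensor `R_{ik} = g^{jl} R_{ijkl}`. -/
def ric (G : E4 → Matrix (Fin 4) (Fin 4) ℝ) (i k : Fin 4) (u : E4) : ℝ :=
  ∑ j, ∑ l, gInv G j l u * riem G i j k l u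

/-- The Ricci tensor as an endomorphism: `R^i_k = g^{ij} R_{jk}`. -/
def ricEndo (G : E4 → Matrix (Fin 4) (Fin 4) ℝ) (u : E4) : Module.End ℝ (Fin 4 → ℝ) :=
  Matrix.toLin' (Matrix.of fun i k => ∑ j, gInv G i j u * ric G j k u)

/-- The scalar curvature `R = g^{ij} R_{ij}`. -/
def scal (G : E4 → Matrix (Fin 4) (Fin 4) ℝ) (u : E4) : ℝ :=
  ∑ i, ∑ j, gInv G i j u * ric G i j u

/-- The Weyl tensor `W_{ijkl}` in dimension four. -/
def weyl (G : E4 → Matrix (Fin 4) (Fin 4) ℝ) (i j k l : Fin 4) (u : E4) : ℝ :=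
  riem G i j k l u
    - (1 / 2) * (ric G i k u * G u j l + ric G j l u * G u i k
        - ric G i l u * G u j k - ric G j k u * G u i l)
    + (scal G u / 6) * (G u i k * G u j l - G u i l * G u j k)

/-- The permutation symbol `[ijkl]`: the sign of `(1234) ↦ (ijkl)`, or `0` if an index repeats. -/
def permSymbol (i j k l : Fin 4) : ℝ :=
  Matrix.det (Matrix.of fun a b : Fin 4 => if ![i, j, k, l] a = b then (1 : ℝ) else 0)

/-- The Riemannian volume form `s √(det g) [ijkl]`, where `s = ±1` tells whether the coordinate
frame is positively or negatively oriented. -/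
def volForm (G : E4 → Matrix (Fin 4) (Fin 4) ℝ) (s : E4 → ℝ) (i j k l : Fin 4) (u : E4) : ℝ :=
  s u * Real.sqrt (G u).det * permSymbol i j k l

/-- The Hodge star on 2-forms, `(⋆ω)_{ij} = ∑_{a,b} ⋆_{ij}^{ab} ω_{ab}` with
`⋆_{ij}^{ab} = ½ ε_{ijcd} g^{ca} g^{db}`. In a positively oriented orthonormal frame
`(⋆ω)_{ij} = ω_{i'j'}`, where `(i j i' j')` is an even permutation of `(1 2 3 4)`. -/
def hodge (G : E4 → Matrix (Fin 4) (Fin 4) ℝ) (s : E4 → ℝ) (i j a b : Fin 4) (u : E4) : ℝ :=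
  (1 / 2) * ∑ c, ∑ d, volForm G s i j c d u * gInv G c a u * gInv G d b u

/-- The self-dual (`σ = 1`) or anti-self-dual (`σ = -1`) part of the Weyl tensor,
`W^±_{ijkl} = ¼ (W_{ijkl} ± W_{ijk'l'} ± W_{i'j'kl} + W_{i'j'k'l'})`. -/
def halfWeyl (G : E4 → Matrix (Fin 4) (Fin 4) ℝ) (s : E4 → ℝ) (σ : ℝ)
    (i j k l : Fin 4) (u : E4) : ℝ :=
  (1 / 4) * (weyl G i j k l u
    + σ * (∑ a, ∑ b, hodge G s k l a b u * weyl G i j a b u)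
    + σ * (∑ a, ∑ b, hodge G s i j a b u * weyl G a b k l u)
    + ∑ a, ∑ b, ∑ c, ∑ d, hodge G s i j a b u * hodge G s k l c d u * weyl G a b c d u)

/-- The covariant derivative `∇_p T_{ijkl}` of a `(0,4)`-tensor. -/
def covDeriv4 (G : E4 → Matrix (Fin 4) (Fin 4) ℝ)
    (T : Fin 4 → Fin 4 → Fin 4 → Fin 4 → E4 → ℝ) (p i j k l : Fin 4) (u : E4) : ℝ :=
  pd p (T i j k l) u
    - ∑ a, (Gam G a p i u * T a j k l u + Gam G a p j u * T i a k l u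
        + Gam G a p k u * T i j a l u + Gam G a p l u * T i j k a u)

/-- The divergence `(δT)_{jkl} = ∇^i T_{ijkl} = g^{ip} ∇_p T_{ijkl}`. -/
def div4 (G : E4 → Matrix (Fin 4) (Fin 4) ℝ)
    (T : Fin 4 → Fin 4 → Fin 4 → Fin 4 → E4 → ℝ) (j k l : Fin 4) (u : E4) : ℝ :=
  ∑ i, ∑ p, gInv G i p u * covDeriv4 G T p i j k l u

/-- The Hessian `∇_i ∇_j F = ∂_i ∂_j F - Γ^k_{ij} ∂_k F`. -/
def hess (G : E4 → Matrix (Fin 4) (Fin 4) ℝ) (F : E4 → ℝ) (i j : Fin 4) (u : E4) : ℝ :=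
  pd i (pd j F) u - ∑ k, Gam G k i j u * pd k F u

/-- The components `∇^i F = g^{ij} ∂_j F` of the gradient. -/
def grad (G : E4 → Matrix (Fin 4) (Fin 4) ℝ) (F : E4 → ℝ) (u : E4) : Fin 4 → ℝ :=
  fun i => ∑ j, gInv G i j u * pd j F u

/-! ## Oriented Riemannian four-manifolds -/

section Manifold

variable {M : Type*} [TopologicalSpace M] [ChartedSpace E4 M]

/-- The coordinate vector `∂_i` of the chart `φ`, at the point with coordinates `u`. -/
def coordVec (φ : OpenPartialHomeomorph M E4) (u : E4) (i : Fin 4) :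
    TangentSpace (𝓡 4) (φ.symm u) :=
  mfderiv (𝓡 4) (𝓡 4) φ.symm u
    ((EuclideanSpace.single i (1 : ℝ) : E4) : TangentSpace (𝓡 4) u)

/-- The sign of the coordinate frame `(∂_1, …, ∂_4)` of `φ` at `φ.symm u` with respect to an
orientation of that tangent space. -/
def frameSign (o : ∀ p : M, Orientation ℝ (TangentSpace (𝓡 4) p) (Fin 4))
    (φ : OpenPartialHomeomorph M E4) (u : E4) : ℝ :=
  Real.sign ((o (φ.symm u)).someVector (coordVec φ u))

variable (M) in
/-- An orientation of `M`: an orientation of every tangent space, such that in every smooth chart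
the sign of the coordinate frame is continuous, that is, locally constant. -/
structure ManifoldOrientation [IsManifold (𝓡 4) ∞ M] where
  /-- the orientation of the tangent space at a point -/
  toFun : ∀ p : M, Orientation ℝ (TangentSpace (𝓡 4) p) (Fin 4)
  continuousOn_sign : ∀ φ ∈ IsManifold.maximalAtlas (𝓡 4) ∞ M,
    ContinuousOn (frameSign toFun φ) φ.target

variable [IsManifold (𝓡 4) ∞ M]

variable (M) in
/-- A smooth Riemannian metric on `M`. -/
abbrev Metric : Type _ :=
  Bundle.ContMDiffRiemannianMetric (𝓡 4) ∞ E4 (fun p : M => TangentSpace (𝓡 4) p)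

/-- The components `g_ij = g(∂_i, ∂_j)` of the metric in the chart `φ`. -/
def Metric.coeff (g : Metric M) (φ : OpenPartialHomeomorph M E4) (u : E4) :
    Matrix (Fin 4) (Fin 4) ℝ :=
  Matrix.of fun i j => g.inner (φ.symm u) (coordVec φ u i) (coordVec φ u j)

/-- `(M, g, f)` is a gradient Ricci soliton: `f` is smooth and `Ric + ∇²f = λ g` for a constant
`λ` (written `c`). -/
def IsGradientRicciSoliton (g : Metric M) (f : M → ℝ) : Prop :=
  ContMDiff (𝓡 4) 𝓘(ℝ, ℝ) ∞ f ∧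
  ∃ c : ℝ, ∀ φ ∈ IsManifold.maximalAtlas (𝓡 4) ∞ M, ∀ u ∈ φ.target, ∀ i j : Fin 4,
    ric (g.coeff φ) i j u + hess (g.coeff φ) (f ∘ φ.symm) i j u = c * g.coeff φ u i j

/-- `δW^+ = 0` (`σ = 1`), respectively `δW^- = 0` (`σ = -1`), on all of `M`. -/
def HarmonicHalfWeyl (g : Metric M) (o : ManifoldOrientation M) (σ : ℝ) : Prop :=
  ∀ φ ∈ IsManifold.maximalAtlas (𝓡 4) ∞ M, ∀ u ∈ φ.target, ∀ j k l : Fin 4,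
    div4 (g.coeff φ) (halfWeyl (g.coeff φ) (frameSign o.toFun φ) σ) j k l u = 0

end Manifold

end HalfWeyl

end

/-!
In a general chart the statement mixes third derivatives of the metric with Christoffel symbols, but
the conclusion can be phrased without curvature: since `∂_i |∇f|² = 2 (∇_i ∇_j f) ∇^j f`
(`pd_gradSq`) and `Ric = λ g - ∇²f`, the gradient is an eigenvector of the Ricci tensor wherever
it is nonzero and `d|∇f|²` is proportional to `df` (`hasEigenvector_grad`). The function `|∇f|²` is
defined without reference to a chart, so this proportionality may be checked at a point `p` in
whatever chart is convenient (`gradSq_comp`, `pd_wedge_of_comp`). The hypotheses hold in every chart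
of the maximal atlas, and one of these is orthonormal with vanishing first derivatives of the metric
at `p` (`exists_normal_map`, `exists_chart_comp`). There all Christoffel symbols vanish, and the
first derivatives of the curvature become linear in the third derivatives of the metric.

In such a chart, the second Bianchi identity gives `2 δW = C`, the Cotton tensor
`C_{jkl} = ∇_k R_{lj} - ∇_l R_{kj} - ⅙ (∇_k R g_{jl} - ∇_l R g_{jk})` (`two_mul_div_weylPart`). The
Hodge star is parallel and commutes with the Weyl tensor (`hodgeStar_comm`), so `δW^± = 0` says that
`C_{jkl}` is anti-self-dual, respectively self-dual, in `kl` (`four_mul_div_halfWeyl`). On a soliton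
the Ricci identity gives `∇_k R_{lj} - ∇_l R_{kj} = R_{klmj} ∇^m f`. The contraction of the right
hand side with `∇^j f` is zero, so that `C_{jkl} ∇^j f` is a multiple of the decomposable two-form
`dR ∧ df`. A decomposable two-form `α` satisfies `α ∧ α = 0`, hence it vanishes if it is self-dual
or anti-self-dual (`wedge_eq_zero`). Finally the trace of the same identity is `dR = 2 Ric(∇f)`, and
`2 Ric(∇f) = 2 λ df - d|∇f|²`, so `d|∇f|² ∧ df = 0` (`IsNormalAt.pd_gradSq_wedge`).
-/

noncomputable section

namespace HalfWeyl

open Filter Topology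
open scoped Matrix

/-! ### Calculus of partial derivatives -/

section Calculus

variable {u : E4} {A B F : E4 → ℝ}

theorem differentiableAt_of_contDiffAt (hF : ContDiffAt ℝ ∞ F u) : DifferentiableAt ℝ F u :=
  hF.differentiableAt (by simp)

theorem contDiffAt_pd (hF : ContDiffAt ℝ ∞ F u) (i : Fin 4) : ContDiffAt ℝ ∞ (pd i F) u :=
  (hF.fderiv_right (m := ∞) (by simp)).clm_apply contDiffAt_const

theorem eventually_contDiffAt (hF : ContDiffAt ℝ ∞ F u) (n : ℕ) :
    ∀ᶠ v in 𝓝 u, ContDiffAt ℝ n F v :=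
  (hF.of_le (by exact_mod_cast le_top)).eventually (by simp)

theorem eventually_differentiableAt (hF : ContDiffAt ℝ ∞ F u) :
    ∀ᶠ v in 𝓝 u, DifferentiableAt ℝ F v :=
  (eventually_contDiffAt hF 1).mono fun _ h => h.differentiableAt (by simp)

theorem pd_congr (h : A =ᶠ[𝓝 u] B) (i : Fin 4) : pd i A u = pd i B u := by
  simp only [pd, h.fderiv_eq]

theorem pd_const (c : ℝ) (i : Fin 4) : pd i (fun _ => c) u = 0 := by
  simp [pd]

theorem pd_add (hA : DifferentiableAt ℝ A u) (hB : DifferentiableAt ℝ B u) (i : Fin 4) :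
    pd i (fun v => A v + B v) u = pd i A u + pd i B u := by
  simp [pd, fderiv_fun_add hA hB]

theorem pd_sub (hA : DifferentiableAt ℝ A u) (hB : DifferentiableAt ℝ B u) (i : Fin 4) :
    pd i (fun v => A v - B v) u = pd i A u - pd i B u := by
  simp [pd, fderiv_fun_sub hA hB]

theorem pd_mul (hA : DifferentiableAt ℝ A u) (hB : DifferentiableAt ℝ B u) (i : Fin 4) :
    pd i (fun v => A v * B v) u = pd i A u * B u + A u * pd i B u := by
  simp [pd, fderiv_fun_mul hA hB]; ring

theorem pd_const_mul (hA : DifferentiableAt ℝ A u) (c : ℝ) (i : Fin 4) :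
    pd i (fun v => c * A v) u = c * pd i A u := by
  simp [pd, fderiv_const_mul hA]

theorem pd_sum {ι : Type*} {s : Finset ι} {A : ι → E4 → ℝ}
    (hA : ∀ a ∈ s, DifferentiableAt ℝ (A a) u) (i : Fin 4) :
    pd i (fun v => ∑ a ∈ s, A a v) u = ∑ a ∈ s, pd i (A a) u := by
  simp [pd, fderiv_fun_sum hA]

theorem pd_comm_eventually (hF : ContDiffAt ℝ ∞ F u) (i j : Fin 4) :
    pd i (pd j F) =ᶠ[𝓝 u] pd j (pd i F) := by
  have h2 := eventually_contDiffAt hF 2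
  filter_upwards [h2] with v hv
  have key : ∀ i j : Fin 4, pd i (pd j F) v
      = fderiv ℝ (fderiv ℝ F) v (EuclideanSpace.single i 1) (EuclideanSpace.single j 1) := by
    intro i j
    have h : DifferentiableAt ℝ (fderiv ℝ F) v :=
      (hv.fderiv_right (m := 1) (by norm_num)).differentiableAt (by simp)
    change fderiv ℝ (fun v => fderiv ℝ F v (EuclideanSpace.single j 1)) v _ = _
    rw [fderiv_clm_apply h (differentiableAt_const _)]
    simp
  rw [key, key]
  exact (hv.isSymmSndFDerivAt (by simp)).eq _ _

theorem pd_comm (hF : ContDiffAt ℝ ∞ F u) (i j : Fin 4) :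
    pd i (pd j F) u = pd j (pd i F) u :=
  (pd_comm_eventually hF i j).eq_of_nhds

/-- Second derivative of a product `A B` at a point where `dA` and `B` vanish. -/
theorem pd_pd_mul (hA : ContDiffAt ℝ ∞ A u) (hB : ContDiffAt ℝ ∞ B u)
    (hA0 : ∀ k, pd k A u = 0) (hB0 : B u = 0) (i j : Fin 4) :
    pd i (pd j (fun v => A v * B v)) u = A u * pd i (pd j B) u := by
  have h : pd j (fun v => A v * B v) =ᶠ[𝓝 u] fun v => pd j A v * B v + A v * pd j B v := by
    filter_upwards [eventually_differentiableAt hA, eventually_differentiableAt hB] with v h1 h2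
    exact pd_mul h1 h2 j
  have dA := differentiableAt_of_contDiffAt hA
  have dB := differentiableAt_of_contDiffAt hB
  have dA' := differentiableAt_of_contDiffAt (contDiffAt_pd hA j)
  have dB' := differentiableAt_of_contDiffAt (contDiffAt_pd hB j)
  rw [pd_congr h, pd_add (dA'.fun_mul dB) (dA.fun_mul dB'), pd_mul dA' dB, pd_mul dA dB']
  simp [hA0, hB0]

theorem fderiv_eq_sum_pd (F : E4 → ℝ) (u x : E4) :
    fderiv ℝ F u x = ∑ i, x i * pd i F u := by
  have hx : x = ∑ i, x i • (EuclideanSpace.single i (1 : ℝ) : E4) := by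
    ext j
    simp [Finset.sum_apply, Pi.single_apply]
  conv_lhs => rw [hx]
  simp [pd]

theorem fderiv_eq_zero_of_pd (h : ∀ k, pd k F u = 0) : fderiv ℝ F u = 0 := by
  ext x
  rw [fderiv_eq_sum_pd]
  simp [h]

end Calculus

/-! ### The inverse metric and the determinant -/

section Inverse

variable {u : E4} {G : E4 → Matrix (Fin 4) (Fin 4) ℝ}

theorem contDiffAt_det (hG : ∀ i j, ContDiffAt ℝ ∞ (fun v => G v i j) u) :
    ContDiffAt ℝ ∞ (fun v => (G v).det) u := by
  simp only [Matrix.det_apply]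
  refine ContDiffAt.sum fun p _ => ContDiffAt.const_smul _ ?_
  exact contDiffAt_prod fun i _ => hG _ _

theorem contDiffAt_gInv (hG : ∀ i j, ContDiffAt ℝ ∞ (fun v => G v i j) u)
    (hdet : (G u).det ≠ 0) (i j : Fin 4) : ContDiffAt ℝ ∞ (gInv G i j) u := by
  have h : gInv G i j
      = fun v => ((G v).det)⁻¹ * ((G v).updateRow j (Pi.single i 1)).det := by
    funext v
    simp [gInv, Matrix.inv_def, Matrix.adjugate_apply]
  rw [h]
  refine ((contDiffAt_det hG).inv hdet).mul (contDiffAt_det fun a b => ?_)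
  by_cases hab : a = j
  · subst hab
    simpa using contDiffAt_const
  · simpa [Matrix.updateRow_ne hab] using hG a b

theorem eventually_det_ne_zero (hG : ∀ i j, ContDiffAt ℝ ∞ (fun v => G v i j) u)
    (hdet : (G u).det ≠ 0) : ∀ᶠ v in 𝓝 u, (G v).det ≠ 0 :=
  (contDiffAt_det hG).continuousAt.eventually_ne hdet

theorem sum_gInv_mul {v : E4} (hdet : (G v).det ≠ 0) (i j : Fin 4) :
    ∑ k, gInv G i k v * G v k j = if i = j then 1 else 0 := by
  have h := Matrix.nonsing_inv_mul (G v) (isUnit_iff_ne_zero.mpr hdet)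
  have := congrFun (congrFun h i) j
  simpa [gInv, Matrix.mul_apply, Matrix.one_apply] using this

theorem sum_mul_gInv {v : E4} (hdet : (G v).det ≠ 0) (i j : Fin 4) :
    ∑ k, G v i k * gInv G k j v = if i = j then 1 else 0 := by
  have h := Matrix.mul_nonsing_inv (G v) (isUnit_iff_ne_zero.mpr hdet)
  have := congrFun (congrFun h i) j
  simpa [gInv, Matrix.mul_apply, Matrix.one_apply] using this

/-- `∂_p g^{ij} = - g^{ia} (∂_p g_ab) g^{bj}`. -/
theorem pd_gInv (hG : ∀ i j, ContDiffAt ℝ ∞ (fun v => G v i j) u) (hdet : (G u).det ≠ 0)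
    (p i j : Fin 4) : pd p (gInv G i j) u
      = - ∑ a, ∑ b, gInv G i a u * pd p (fun v => G v a b) u * gInv G b j u := by
  have dI := fun i j => differentiableAt_of_contDiffAt (contDiffAt_gInv hG hdet i j)
  have dG := fun i j => differentiableAt_of_contDiffAt (hG i j)
  have h0 : ∀ b, ∑ k, pd p (gInv G i k) u * G u k b
      = - ∑ k, gInv G i k u * pd p (fun v => G v k b) u := by
    intro b
    have h1 : pd p (fun v => ∑ k, gInv G i k v * (fun v => G v k b) v) u = 0 := by
      rw [pd_congr (B := fun _ => if i = b then 1 else 0)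
        ((eventually_det_ne_zero hG hdet).mono fun v hv => sum_gInv_mul hv i b), pd_const]
    rw [pd_sum fun k _ => (dI i k).fun_mul (dG k b)] at h1
    simp only [pd_mul (dI i _) (dG _ b), Finset.sum_add_distrib] at h1
    linarith
  have h2 : ∑ b, (∑ k, pd p (gInv G i k) u * G u k b) * gInv G b j u = pd p (gInv G i j) u := by
    simp only [Finset.sum_mul]
    rw [Finset.sum_comm]
    simp only [mul_assoc, ← Finset.mul_sum, sum_mul_gInv hdet]
    simp
  rw [← h2]
  simp only [h0, neg_mul, Finset.sum_neg_distrib, Finset.sum_mul]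
  rw [Finset.sum_comm]

end Inverse

/-! ### The squared norm of a gradient -/

/-- The function `|∇F|² = g^{ab} ∂_a F ∂_b F`. -/
def gradSq (G : E4 → Matrix (Fin 4) (Fin 4) ℝ) (F : E4 → ℝ) (u : E4) : ℝ :=
  ∑ a, ∑ b, gInv G a b u * pd a F u * pd b F u

theorem gInv_symm {G : E4 → Matrix (Fin 4) (Fin 4) ℝ} {u : E4}
    (hs : ∀ i j, G u i j = G u j i) (i j : Fin 4) : gInv G i j u = gInv G j i u := by
  have h : (G u).IsSymm := Matrix.IsSymm.ext fun i j => hs _ _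
  exact (Matrix.IsSymm.ext_iff.mp h.inv) j i

/-- `∂_i |∇F|² = 2 (∇_i ∇_a F) ∇^a F`. -/
theorem pd_gradSq {G : E4 → Matrix (Fin 4) (Fin 4) ℝ} {F : E4 → ℝ} {u : E4}
    (hG : ∀ i j, ContDiffAt ℝ ∞ (fun v => G v i j) u) (hdet : (G u).det ≠ 0)
    (hs : ∀ v i j, G v i j = G v j i) (hF : ContDiffAt ℝ ∞ F u) (i : Fin 4) :
    pd i (gradSq G F) u = 2 * ∑ a, hess G F i a u * grad G F u a := by
  have dI := fun i j => differentiableAt_of_contDiffAt (contDiffAt_gInv hG hdet i j)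
  have dF := fun i => differentiableAt_of_contDiffAt (contDiffAt_pd hF i)
  have hsI := gInv_symm (hs u)
  set X := grad G F u with hX
  have hXe : ∀ a, ∑ b, gInv G a b u * pd b F u = X a := fun a => rfl
  have hXe' : ∀ a, ∑ b, pd b F u * gInv G b a u = X a := fun a => by
    rw [← hXe]; exact Finset.sum_congr rfl fun b _ => by rw [hsI b a, mul_comm]
  -- the left hand side is `- ∂_i g_ab F^a F^b + 2 ∂_i ∂_a F F^a`
  have hL : pd i (gradSq G F) u = - ∑ a, ∑ b, pd i (fun v => G v a b) u * X a * X b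
      + 2 * ∑ a, pd i (pd a F) u * X a := by
    have e1 : pd i (gradSq G F) u = ∑ a, ∑ b, (pd i (gInv G a b) u * pd a F u * pd b F u
        + gInv G a b u * pd i (pd a F) u * pd b F u
        + gInv G a b u * pd a F u * pd i (pd b F) u) := by
      unfold gradSq
      rw [pd_sum fun a _ => DifferentiableAt.fun_sum fun b _ =>
        ((dI a b).fun_mul (dF a)).fun_mul (dF b)]
      refine Finset.sum_congr rfl fun a _ => ?_
      rw [pd_sum fun b _ => ((dI a b).fun_mul (dF a)).fun_mul (dF b)]
      refine Finset.sum_congr rfl fun b _ => ?_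
      rw [pd_mul ((dI a b).fun_mul (dF a)) (dF b), pd_mul (dI a b) (dF a)]
      ring
    have e2 : ∑ a, ∑ b, gInv G a b u * pd i (pd a F) u * pd b F u
        = ∑ a, pd i (pd a F) u * X a := by
      refine Finset.sum_congr rfl fun a _ => ?_
      rw [← hXe, Finset.mul_sum]
      exact Finset.sum_congr rfl fun b _ => by ring
    have e3 : ∑ a, ∑ b, gInv G a b u * pd a F u * pd i (pd b F) u
        = ∑ a, pd i (pd a F) u * X a := by
      rw [Finset.sum_comm]
      refine Finset.sum_congr rfl fun a _ => ?_
      rw [← hXe', Finset.mul_sum]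
      exact Finset.sum_congr rfl fun b _ => by ring
    have e4 : ∑ a, ∑ b, pd i (gInv G a b) u * pd a F u * pd b F u
        = - ∑ a, ∑ b, pd i (fun v => G v a b) u * X a * X b := by
      simp only [pd_gInv hG hdet, ← hXe]
      simp only [Fin.sum_univ_four]
      simp only [hsI 1 0, hsI 2 0, hsI 3 0, hsI 2 1, hsI 3 1, hsI 3 2]
      ring
    rw [e1]
    simp only [Finset.sum_add_distrib]
    rw [e2, e3, e4]
    ring
  -- lowering the index of the Christoffel symbol
  have hΓ : ∀ a, ∑ k, Gam G k i a u * pd k F u = (1 / 2) * ∑ l, X l *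
      (pd i (fun v => G v a l) u + pd a (fun v => G v i l) u - pd l (fun v => G v i a) u) := by
    intro a
    simp only [Gam, Finset.sum_mul, Finset.mul_sum, ← hXe']
    rw [Finset.sum_comm]
    refine Finset.sum_congr rfl fun l _ => Finset.sum_congr rfl fun k _ => by ring
  rw [hL]
  simp only [hess, hΓ]
  have hc : ∀ a l, (fun v => G v a l) = fun v => G v l a := fun a l => funext fun v => hs v a l
  simp only [Fin.sum_univ_four]
  rw [hc 1 0, hc 2 0, hc 3 0, hc 2 1, hc 3 1, hc 3 2]
  ring

/-! ### The Hodge star on two-forms in an orthonormal frame -/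

theorem permSymbol_eq_int (i j k l : Fin 4) : permSymbol i j k l
    = ((Matrix.det (Matrix.of fun a b : Fin 4 =>
        if ![i, j, k, l] a = b then (1 : ℤ) else 0) : ℤ) : ℝ) := by
  refine Eq.trans ?_ (RingHom.map_det (Int.castRingHom ℝ) _).symm
  rw [permSymbol]
  congr 1
  ext a b
  by_cases h : ![i, j, k, l] a = b <;> simp [h]

/-- The permutation symbol is a normalized Vandermonde product. -/
theorem permSymbol_eq (i j k l : Fin 4) : permSymbol i j k l
    = ((((j : ℤ) - i) * (k - i) * (l - i) * (k - j) * (l - j) * (l - k) / 12 : ℤ) : ℝ) := by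
  rw [permSymbol_eq_int]
  congr 1
  revert i j k l
  decide +kernel

/-- The Hodge star `(⋆η)_{kl} = ½ [klab] η_{ab}` of `ℝ⁴` with its standard orientation. -/
def hodgeStar (η : Fin 4 → Fin 4 → ℝ) (k l : Fin 4) : ℝ :=
  (1 / 2) * ∑ a, ∑ b, permSymbol k l a b * η a b

theorem antisymm_ext {A B : Fin 4 → Fin 4 → ℝ} (hA : ∀ i j, A i j = - A j i)
    (hB : ∀ i j, B i j = - B j i) (h01 : A 0 1 = B 0 1) (h02 : A 0 2 = B 0 2)
    (h03 : A 0 3 = B 0 3) (h12 : A 1 2 = B 1 2) (h13 : A 1 3 = B 1 3) (h23 : A 2 3 = B 2 3)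
    (i j : Fin 4) : A i j = B i j := by
  have dA : ∀ i, A i i = 0 := fun i => by linarith [hA i i]
  have dB : ∀ i, B i i = 0 := fun i => by linarith [hB i i]
  fin_cases i <;> fin_cases j <;> simp only [Fin.zero_eta, Fin.mk_one, Fin.reduceFinMk] <;>
    first
    | rw [dA, dB]
    | assumption
    | (rw [hA, hB, neg_inj]; assumption)

section

variable {η : Fin 4 → Fin 4 → ℝ}

theorem hodgeStar_antisymm (η : Fin 4 → Fin 4 → ℝ) (i j : Fin 4) :
    hodgeStar η i j = - hodgeStar η j i := by
  have h : ∀ a b, permSymbol i j a b = - permSymbol j i a b := by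
    intro a b
    simp only [permSymbol_eq_int]
    rw [← Int.cast_neg]
    congr 1
    revert i j a b
    decide +kernel
  simp only [hodgeStar, h, neg_mul, Finset.sum_neg_distrib, mul_neg]

theorem hodgeStar_zero_one (h : ∀ i j, η i j = - η j i) : hodgeStar η 0 1 = η 2 3 := by
  simp only [hodgeStar, permSymbol_eq, Fin.sum_univ_four]
  norm_num
  linarith [h 2 3]

theorem hodgeStar_zero_two (h : ∀ i j, η i j = - η j i) : hodgeStar η 0 2 = - η 1 3 := by
  simp only [hodgeStar, permSymbol_eq, Fin.sum_univ_four]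
  norm_num
  linarith [h 1 3]

theorem hodgeStar_zero_three (h : ∀ i j, η i j = - η j i) : hodgeStar η 0 3 = η 1 2 := by
  simp only [hodgeStar, permSymbol_eq, Fin.sum_univ_four]
  norm_num
  linarith [h 1 2]

theorem hodgeStar_one_two (h : ∀ i j, η i j = - η j i) : hodgeStar η 1 2 = η 0 3 := by
  simp only [hodgeStar, permSymbol_eq, Fin.sum_univ_four]
  norm_num
  linarith [h 0 3]

theorem hodgeStar_one_three (h : ∀ i j, η i j = - η j i) : hodgeStar η 1 3 = - η 0 2 := by
  simp only [hodgeStar, permSymbol_eq, Fin.sum_univ_four]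
  norm_num
  linarith [h 0 2]

theorem hodgeStar_two_three (h : ∀ i j, η i j = - η j i) : hodgeStar η 2 3 = η 0 1 := by
  simp only [hodgeStar, permSymbol_eq, Fin.sum_univ_four]
  norm_num
  linarith [h 0 1]

theorem hodgeStar_hodgeStar (h : ∀ i j, η i j = - η j i) (i j : Fin 4) :
    hodgeStar (hodgeStar η) i j = η i j := by
  have hs := hodgeStar_antisymm η
  refine antisymm_ext (hodgeStar_antisymm _) h ?_ ?_ ?_ ?_ ?_ ?_ i j
  · rw [hodgeStar_zero_one hs, hodgeStar_two_three h]
  · rw [hodgeStar_zero_two hs, hodgeStar_one_three h, neg_neg]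
  · rw [hodgeStar_zero_three hs, hodgeStar_one_two h]
  · rw [hodgeStar_one_two hs, hodgeStar_zero_three h]
  · rw [hodgeStar_one_three hs, hodgeStar_zero_two h, neg_neg]
  · rw [hodgeStar_two_three hs, hodgeStar_zero_one h]

end

theorem hodgeStar_sum (η : Fin 4 → Fin 4 → Fin 4 → ℝ) (k l : Fin 4) :
    hodgeStar (fun a b => ∑ i, η i a b) k l = ∑ i, hodgeStar (η i) k l := by
  simp only [hodgeStar, Fin.sum_univ_four]
  ring

theorem hodgeStar_const_mul (c : ℝ) (η : Fin 4 → Fin 4 → ℝ) (k l : Fin 4) :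
    hodgeStar (fun a b => c * η a b) k l = c * hodgeStar η k l := by
  simp only [hodgeStar, Finset.mul_sum]
  exact Finset.sum_congr rfl fun a _ => Finset.sum_congr rfl fun b _ => by ring

/-- A decomposable two-form `α = x ∧ y` is orthogonal to `⋆α`, because `α ∧ α = 0`; hence
`r α = t ⋆α` with `r > 0` forces `α = 0`. -/
theorem wedge_eq_zero {x y : Fin 4 → ℝ} {t r : ℝ} (hr : 0 < r)
    (h : ∀ k l, r * (x k * y l - x l * y k) = t * hodgeStar (fun a b => x a * y b - x b * y a) k l)
    (k l : Fin 4) : x k * y l = x l * y k := by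
  have ha : ∀ i j, (fun a b => x a * y b - x b * y a) i j
      = - (fun a b => x a * y b - x b * y a) j i := fun i j => by simp
  have e01 := h 0 1
  have e02 := h 0 2
  have e03 := h 0 3
  have e12 := h 1 2
  have e13 := h 1 3
  have e23 := h 2 3
  rw [hodgeStar_zero_one ha] at e01
  rw [hodgeStar_zero_two ha] at e02
  rw [hodgeStar_zero_three ha] at e03
  rw [hodgeStar_one_two ha] at e12
  rw [hodgeStar_one_three ha] at e13
  rw [hodgeStar_two_three ha] at e23
  -- the multiple of `t` on the right is twice the Plücker relation of `x ∧ y`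
  have key : r * ((x 0 * y 1 - x 1 * y 0) ^ 2 + (x 0 * y 2 - x 2 * y 0) ^ 2
      + (x 0 * y 3 - x 3 * y 0) ^ 2 + (x 1 * y 2 - x 2 * y 1) ^ 2
      + (x 1 * y 3 - x 3 * y 1) ^ 2 + (x 2 * y 3 - x 3 * y 2) ^ 2) = 0 := by
    linear_combination (x 0 * y 1 - x 1 * y 0) * e01 + (x 0 * y 2 - x 2 * y 0) * e02
      + (x 0 * y 3 - x 3 * y 0) * e03 + (x 1 * y 2 - x 2 * y 1) * e12
      + (x 1 * y 3 - x 3 * y 1) * e13 + (x 2 * y 3 - x 3 * y 2) * e23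
  have key' := (mul_eq_zero.mp key).resolve_left hr.ne'
  have z : ∀ k l, (x k * y l - x l * y k) = 0 := by
    refine antisymm_ext ha (B := fun _ _ => 0) (by simp) ?_ ?_ ?_ ?_ ?_ ?_ <;>
    · apply pow_eq_zero_iff (two_ne_zero) |>.mp
      refine le_antisymm ?_ (sq_nonneg _)
      linarith [sq_nonneg (x 0 * y 1 - x 1 * y 0), sq_nonneg (x 0 * y 2 - x 2 * y 0),
        sq_nonneg (x 0 * y 3 - x 3 * y 0), sq_nonneg (x 1 * y 2 - x 2 * y 1),
        sq_nonneg (x 1 * y 3 - x 3 * y 1), sq_nonneg (x 2 * y 3 - x 3 * y 2)]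
  linarith [z k l]

/-- The Hodge star commutes with a trace-free algebraic curvature tensor, viewed as an operator
on two-forms. -/
theorem hodgeStar_comm {V : Fin 4 → Fin 4 → Fin 4 → Fin 4 → ℝ}
    (h12 : ∀ i j k l, V i j k l = - V j i k l) (h34 : ∀ i j k l, V i j k l = - V i j l k)
    (hp : ∀ i j k l, V i j k l = V k l i j) (htr : ∀ j l, ∑ i, V i j i l = 0)
    (i j k l : Fin 4) : hodgeStar (fun a b => V a b k l) i j = hodgeStar (V i j) k l := by
  have c1 : ∀ k l, ∀ i j, (fun a b => V a b k l) i j = - (fun a b => V a b k l) j i :=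
    fun k l i j => h12 _ _ _ _
  have c2 : ∀ i j, ∀ k l, V i j k l = - V i j l k := h34
  have r1 : ∀ k l i j,
      hodgeStar (fun a b => V a b k l) i j = - hodgeStar (fun a b => V a b l k) i j := by
    intro k l i j
    have : (fun a b => V a b k l) = fun a b => - V a b l k := by
      funext a b; exact h34 _ _ _ _
    rw [this]
    simp [hodgeStar]
  have r2 : ∀ i j k l, hodgeStar (V i j) k l = - hodgeStar (V j i) k l := by
    intro i j k l
    have : V i j = fun a b => - V j i a b := by
      funext a b; exact h12 _ _ _ _
    rw [this]
    simp [hodgeStar]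
  have d1 : ∀ i k l, V i i k l = 0 := fun i k l => by linarith [h12 i i k l]
  have d2 : ∀ i k l, V k l i i = 0 := fun i k l => by linarith [h34 k l i i]
  have n : ∀ i j, ∀ k l, V i j k l = - V j i k l := fun i j k l => h12 _ _ _ _
  have m : ∀ i j, ∀ k l, V k l i j = - V k l j i := fun i j k l => h34 _ _ _ _
  -- the trace conditions, in terms of the components `V i j k l` with `i < j` and `k < l`
  have t : ∀ j l, V 0 j 0 l + V 1 j 1 l + V 2 j 2 l + V 3 j 3 l = 0 := fun j l => by
    rw [← htr j l, Fin.sum_univ_four]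
  have t00 := t 0 0
  have t11 := t 1 1
  have t22 := t 2 2
  have t33 := t 3 3
  have t01 := t 0 1
  have t02 := t 0 2
  have t03 := t 0 3
  have t12 := t 1 2
  have t13 := t 1 3
  have t23 := t 2 3
  simp only [d1, d2, n 1 0, n 2 0, n 3 0, n 2 1, n 3 1, n 3 2, m 1 0, m 2 0, m 3 0, m 2 1, m 3 1,
    m 3 2, neg_neg, zero_add, add_zero] at t00 t11 t22 t33 t01 t02 t03 t12 t13 t23
  refine antisymm_ext (A := fun i j => hodgeStar (fun a b => V a b k l) i j)
    (B := fun i j => hodgeStar (V i j) k l) (hodgeStar_antisymm _) (fun i j => r2 i j k l)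
    ?_ ?_ ?_ ?_ ?_ ?_ i j <;>
  refine antisymm_ext (A := fun k l => hodgeStar (fun a b => V a b k l) _ _)
    (B := fun k l => hodgeStar (V _ _) k l) (fun k l => r1 k l _ _)
    (fun k l => hodgeStar_antisymm _ k l)
    ?_ ?_ ?_ ?_ ?_ ?_ k l <;>
  simp only [hodgeStar_zero_one (c1 _ _), hodgeStar_zero_two (c1 _ _),
    hodgeStar_zero_three (c1 _ _),
    hodgeStar_one_two (c1 _ _), hodgeStar_one_three (c1 _ _), hodgeStar_two_three (c1 _ _),
    hodgeStar_zero_one (c2 _ _), hodgeStar_zero_two (c2 _ _), hodgeStar_zero_three (c2 _ _),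
    hodgeStar_one_two (c2 _ _), hodgeStar_one_three (c2 _ _), hodgeStar_two_three (c2 _ _)] <;>
  linarith [hp 0 1 2 3, hp 0 2 1 3, hp 0 3 1 2, hp 0 1 0 2, hp 0 1 0 3, hp 0 1 1 2, hp 0 1 1 3,
    hp 0 2 0 3, hp 0 2 1 2, hp 0 2 2 3, hp 0 3 1 3, hp 0 3 2 3, hp 1 2 1 3, hp 1 2 2 3, hp 1 3 2 3]

/-! ### The divergence of the Weyl tensor -/

section Divergence

/-- The Kronecker symbol. -/
def kron (i j : Fin 4) : ℝ := if i = j then 1 else 0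

theorem kron_comm (i j : Fin 4) : kron i j = kron j i := by simp [kron, eq_comm]

theorem sum_kron_mul (f : Fin 4 → ℝ) (i : Fin 4) : ∑ j, kron i j * f j = f i := by
  simp [kron]

theorem sum_mul_kron (f : Fin 4 → ℝ) (i : Fin 4) : ∑ j, f j * kron j i = f i := by
  simp [kron]

/-- The Weyl part `W` of an algebraic curvature tensor on Euclidean four-space. -/
def weylPart (T : Fin 4 → Fin 4 → Fin 4 → Fin 4 → ℝ) (i j k l : Fin 4) : ℝ :=
  T i j k l
    - (1 / 2) * ((∑ a, T i a k a) * kron j l + (∑ a, T j a l a) * kron i k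
        - (∑ a, T i a l a) * kron j k - (∑ a, T j a k a) * kron i l)
    + ((∑ b, ∑ a, T b a b a) / 6) * (kron i k * kron j l - kron i l * kron j k)

variable {T : Fin 4 → Fin 4 → Fin 4 → Fin 4 → ℝ}

theorem weylPart_antisymm_left (h12 : ∀ i j k l, T i j k l = - T j i k l) (i j k l : Fin 4) :
    weylPart T i j k l = - weylPart T j i k l := by
  rw [weylPart, weylPart, h12 i j k l]
  ring

theorem weylPart_antisymm_right (h34 : ∀ i j k l, T i j k l = - T i j l k) (i j k l : Fin 4) :
    weylPart T i j k l = - weylPart T i j l k := by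
  rw [weylPart, weylPart, h34 i j k l]
  ring

theorem weylPart_pair_symm (hp : ∀ i j k l, T i j k l = T k l i j) (i j k l : Fin 4) :
    weylPart T i j k l = weylPart T k l i j := by
  have h : ∀ i k, ∑ a, T i a k a = ∑ a, T k a i a := fun i k =>
    Finset.sum_congr rfl fun a _ => hp _ _ _ _
  rw [weylPart, weylPart, hp i j k l, h i k, h j l, h i l, h j k, kron_comm j l, kron_comm i k,
    kron_comm j k, kron_comm i l]
  ring

theorem weylPart_trace (h12 : ∀ i j k l, T i j k l = - T j i k l)
    (h34 : ∀ i j k l, T i j k l = - T i j l k) (j l : Fin 4) :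
    ∑ i, weylPart T i j i l = 0 := by
  have h : ∑ a, T a j a l = ∑ a, T j a l a :=
    Finset.sum_congr rfl fun a _ => by rw [h12, h34, neg_neg]
  have h4 : ∑ i : Fin 4, kron i i = 4 := by simp [kron]
  have e : ∀ i, weylPart T i j i l = T i j i l
      - (1 / 2) * ((∑ a, T i a i a) * kron j l + (∑ a, T j a l a) * kron i i
        - kron j i * (∑ a, T i a l a) - (∑ a, T j a i a) * kron i l)
      + ((∑ b, ∑ a, T b a b a) / 6) * (kron i i * kron j l - kron j i * kron i l) := by
    intro i
    rw [weylPart, kron_comm j i]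
    ring
  simp only [e, Finset.sum_add_distrib, Finset.sum_sub_distrib, ← Finset.mul_sum,
    ← Finset.sum_mul, sum_kron_mul, sum_mul_kron, h, h4]
  ring

section Bianchi

variable {T : Fin 4 → Fin 4 → Fin 4 → Fin 4 → Fin 4 → ℝ}
  (h12 : ∀ p i j k l, T p i j k l = - T p j i k l)
  (h34 : ∀ p i j k l, T p i j k l = - T p i j l k)
  (hp : ∀ p i j k l, T p i j k l = T p k l i j)
  (hB : ∀ p i j k l, T p i j k l + T i j p k l + T j p i k l = 0)

include h12 h34 hp hB

/-- The contracted second Bianchi identity `∇^i R_{ijkl} = ∇_k R_{lj} - ∇_l R_{kj}`. -/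
theorem div_riem (j k l : Fin 4) :
    ∑ i, T i i j k l = (∑ a, T k l a j a) - (∑ a, T l k a j a) := by
  rw [← Finset.sum_sub_distrib]
  refine Finset.sum_congr rfl fun i _ => ?_
  linarith [hB i k l i j, hp i i j k l, h34 k l i i j, h12 l i k i j, h34 l k i i j]

/-- The twice contracted second Bianchi identity `∇^i R_{ik} = ½ ∇_k R`. -/
theorem div_ric (k : Fin 4) :
    ∑ i, ∑ a, T i i a k a = (1 / 2) * ∑ b, ∑ a, T k b a b a := by
  have h1 : ∑ j, ∑ i, T i i j k j = ∑ i, ∑ a, T i i a k a := Finset.sum_comm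
  have h2 : ∑ j, ∑ a, T j k a j a = ∑ i, ∑ a, T i i a k a :=
    Finset.sum_congr rfl fun j _ => Finset.sum_congr rfl fun a _ => hp _ _ _ _ _
  simp only [div_riem h12 h34 hp hB, Finset.sum_sub_distrib] at h1
  rw [h2] at h1
  linarith

/-- Twice the divergence of the Weyl tensor is the Cotton tensor. -/
theorem two_mul_div_weylPart (j k l : Fin 4) :
    2 * ∑ i, weylPart (T i) i j k l = (∑ a, T k l a j a) - (∑ a, T l k a j a)
      - (1 / 6) * ((∑ b, ∑ a, T k b a b a) * kron j l
        - (∑ b, ∑ a, T l b a b a) * kron j k) := by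
  have hs : ∀ p i k, ∑ a, T p i a k a = ∑ a, T p k a i a := fun p i k =>
    Finset.sum_congr rfl fun a _ => hp _ _ _ _ _
  have e : ∀ i, weylPart (T i) i j k l = T i i j k l
      - (1 / 2) * ((∑ a, T i i a k a) * kron j l + kron k i * (∑ a, T i j a l a)
        - (∑ a, T i i a l a) * kron j k - kron l i * (∑ a, T i j a k a))
      + (1 / 6) * (kron k i * (∑ b, ∑ a, T i b a b a) * kron j l
        - kron l i * (∑ b, ∑ a, T i b a b a) * kron j k) := by
    intro i
    rw [weylPart, kron_comm k i, kron_comm l i]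
    ring
  simp only [e, Finset.sum_add_distrib, Finset.sum_sub_distrib, ← Finset.mul_sum,
    ← Finset.sum_mul, sum_kron_mul, div_riem h12 h34 hp hB, div_ric h12 h34 hp hB, hs k j l,
    hs l j k]
  ring

end Bianchi

end Divergence

/-! ### Curvature and its first derivative at the centre of normal coordinates -/

/-- The metric `G` is smooth at `u`, the coordinate frame is orthonormal there, and the first
derivatives of `G` vanish there. Nothing is required of the higher derivatives. -/
structure IsNormalAt (G : E4 → Matrix (Fin 4) (Fin 4) ℝ) (u : E4) : Prop where
  contDiffAt : ∀ i j, ContDiffAt ℝ ∞ (fun v => G v i j) u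
  symm : ∀ v i j, G v i j = G v j i
  eq_kron : ∀ i j, G u i j = kron i j
  pd_eq_zero : ∀ k i j, pd k (fun v => G v i j) u = 0

theorem pd_mul_of_pd_eq_zero {A B : E4 → ℝ} {u : E4} (hA : ContDiffAt ℝ ∞ A u)
    (hB : ContDiffAt ℝ ∞ B u) {p : Fin 4} (h : pd p A u = 0) :
    pd p (fun v => A v * B v) u = A u * pd p B u := by
  rw [pd_mul (differentiableAt_of_contDiffAt hA) (differentiableAt_of_contDiffAt hB), h]
  ring

/-- `½ (H_{il,jk} - H_{ik,jl} - H_{jl,ik} + H_{jk,il})`: the curvature at the centre of normal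
coordinates, in terms of the second derivatives `H_{ab,ij} = ∂_a ∂_b g_ij` of the metric. -/
def curvOfHess (H : Fin 4 → Fin 4 → Fin 4 → Fin 4 → ℝ) (i j k l : Fin 4) : ℝ :=
  (1 / 2) * (H i l j k - H i k j l - H j l i k + H j k i l)

section

variable {H : Fin 4 → Fin 4 → Fin 4 → Fin 4 → ℝ}

theorem curvOfHess_antisymm_left (i j k l : Fin 4) :
    curvOfHess H i j k l = - curvOfHess H j i k l := by
  unfold curvOfHess; ring

theorem curvOfHess_antisymm_right (i j k l : Fin 4) :
    curvOfHess H i j k l = - curvOfHess H i j l k := by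
  unfold curvOfHess; ring

theorem curvOfHess_pair_symm (h1 : ∀ a b i j, H a b i j = H b a i j)
    (h2 : ∀ a b i j, H a b i j = H a b j i) (i j k l : Fin 4) :
    curvOfHess H i j k l = curvOfHess H k l i j := by
  unfold curvOfHess
  rw [h1 k j, h2 j k l i, h1 k i, h2 i k l j, h1 l j, h2 j l k i, h1 l i, h2 i l k j]
  ring

end

theorem curvOfHess_bianchi {D : Fin 4 → Fin 4 → Fin 4 → Fin 4 → Fin 4 → ℝ}
    (h : ∀ p a b i j, D p a b i j = D a p b i j) (p i j k l : Fin 4) :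
    curvOfHess (D p) i j k l + curvOfHess (D i) j p k l + curvOfHess (D j) p i k l = 0 := by
  unfold curvOfHess
  rw [h i p l j k, h i p k j l, h j p l i k, h j p k i l, h j i l p k, h j i k p l]
  ring

/-- The Christoffel symbol of the first kind `½ (∂_i g_jl + ∂_j g_il - ∂_l g_ij)`. -/
def gamLow (G : E4 → Matrix (Fin 4) (Fin 4) ℝ) (l i j : Fin 4) (u : E4) : ℝ :=
  (1 / 2) * (pd i (fun v => G v j l) u + pd j (fun v => G v i l) u - pd l (fun v => G v i j) u)

theorem Gam_eq (G : E4 → Matrix (Fin 4) (Fin 4) ℝ) (k i j : Fin 4) :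
    Gam G k i j = fun v => ∑ l, gInv G k l v * gamLow G l i j v := by
  funext v
  simp only [Gam, gamLow, Finset.mul_sum]
  exact Finset.sum_congr rfl fun l _ => by ring

section Smooth

variable {G : E4 → Matrix (Fin 4) (Fin 4) ℝ} {u : E4}
  (hG : ∀ i j, ContDiffAt ℝ ∞ (fun v => G v i j) u) (hdet : (G u).det ≠ 0)

include hG

theorem contDiffAt_gamLow (l i j : Fin 4) : ContDiffAt ℝ ∞ (gamLow G l i j) u := by
  have h := fun k i j => contDiffAt_pd (hG i j) k
  unfold gamLow
  fun_prop

include hdet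

theorem contDiffAt_Gam (k i j : Fin 4) : ContDiffAt ℝ ∞ (Gam G k i j) u := by
  rw [Gam_eq]
  exact ContDiffAt.sum fun l _ => (contDiffAt_gInv hG hdet k l).mul (contDiffAt_gamLow hG l i j)

theorem contDiffAt_riemUp (h i j l : Fin 4) : ContDiffAt ℝ ∞ (riemUp G h i j l) u := by
  have h1 := contDiffAt_Gam hG hdet
  have h2 := fun p k i j => contDiffAt_pd (h1 k i j) p
  unfold riemUp
  fun_prop

theorem contDiffAt_riem (i j k l : Fin 4) : ContDiffAt ℝ ∞ (riem G i j k l) u := by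
  have h1 := contDiffAt_riemUp hG hdet
  unfold riem
  fun_prop

theorem contDiffAt_ric (i k : Fin 4) : ContDiffAt ℝ ∞ (ric G i k) u := by
  have h1 := contDiffAt_riem hG hdet
  have h2 := contDiffAt_gInv hG hdet
  unfold ric
  fun_prop

theorem contDiffAt_scal : ContDiffAt ℝ ∞ (scal G) u := by
  have h1 := contDiffAt_ric hG hdet
  have h2 := contDiffAt_gInv hG hdet
  unfold scal
  fun_prop

theorem contDiffAt_weyl (i j k l : Fin 4) : ContDiffAt ℝ ∞ (weyl G i j k l) u := by
  have h1 := contDiffAt_ric hG hdet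
  have h2 := contDiffAt_riem hG hdet
  have h3 := contDiffAt_scal hG hdet
  unfold weyl
  fun_prop

end Smooth

namespace IsNormalAt

variable {G : E4 → Matrix (Fin 4) (Fin 4) ℝ} {u : E4} (h : IsNormalAt G u)

include h

theorem eq_one : G u = 1 := by
  ext i j
  rw [h.eq_kron, Matrix.one_apply, kron]

theorem det_ne_zero : (G u).det ≠ 0 := by
  rw [h.eq_one]; simp

theorem gInv_eq (i j : Fin 4) : gInv G i j u = kron i j := by
  rw [gInv, h.eq_one, inv_one, Matrix.one_apply, kron]

theorem pd_gInv_eq (p i j : Fin 4) : pd p (gInv G i j) u = 0 := by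
  simp [pd_gInv h.contDiffAt h.det_ne_zero, h.pd_eq_zero]

theorem smooth_gInv (i j : Fin 4) : ContDiffAt ℝ ∞ (gInv G i j) u :=
  contDiffAt_gInv h.contDiffAt h.det_ne_zero i j

theorem gamLow_eq (l i j : Fin 4) : gamLow G l i j u = 0 := by
  simp [gamLow, h.pd_eq_zero]

theorem Gam_eq_zero (k i j : Fin 4) : Gam G k i j u = 0 := by
  simp [Gam_eq, h.gamLow_eq]

theorem pd_Gam (p k i j : Fin 4) : pd p (Gam G k i j) u = pd p (gamLow G k i j) u := by
  have h1 := contDiffAt_gamLow h.contDiffAt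
  rw [Gam_eq, pd_sum fun l _ => differentiableAt_of_contDiffAt ((h.smooth_gInv k l).mul (h1 l i j))]
  simp only [pd_mul_of_pd_eq_zero (h.smooth_gInv k _) (h1 _ i j) (h.pd_gInv_eq p k _), h.gInv_eq,
    sum_kron_mul]

theorem pd_pd_Gam (q p k i j : Fin 4) :
    pd q (pd p (Gam G k i j)) u = pd q (pd p (gamLow G k i j)) u := by
  have h1 := contDiffAt_gamLow h.contDiffAt
  have h2 := fun l => (h.smooth_gInv k l).mul (h1 l i j)
  have h3 : pd p (Gam G k i j) =ᶠ[𝓝 u]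
      fun v => ∑ l, pd p (fun w => gInv G k l w * gamLow G l i j w) v := by
    have := fun l => eventually_differentiableAt (h2 l)
    filter_upwards [eventually_all.mpr this] with v hv
    rw [Gam_eq]
    exact pd_sum (fun l _ => hv l) p
  rw [pd_congr h3, pd_sum fun l _ => differentiableAt_of_contDiffAt (contDiffAt_pd (h2 l) p)]
  simp only [pd_pd_mul (h.smooth_gInv k _) (h1 _ i j) (fun p => h.pd_gInv_eq p k _)
    (h.gamLow_eq _ i j), h.gInv_eq, sum_kron_mul]

theorem pd_gamLow (p l i j : Fin 4) : pd p (gamLow G l i j) u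
    = (1 / 2) * (pd p (pd i (fun v => G v j l)) u + pd p (pd j (fun v => G v i l)) u
      - pd p (pd l (fun v => G v i j)) u) := by
  have h1 := fun k i j => differentiableAt_of_contDiffAt (contDiffAt_pd (h.contDiffAt i j) k)
  unfold gamLow
  rw [pd_const_mul (((h1 _ _ _).fun_add (h1 _ _ _)).fun_sub (h1 _ _ _)),
    pd_sub ((h1 _ _ _).fun_add (h1 _ _ _)) (h1 _ _ _), pd_add (h1 _ _ _) (h1 _ _ _)]

theorem pd_pd_gamLow (q p l i j : Fin 4) : pd q (pd p (gamLow G l i j)) u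
    = (1 / 2) * (pd q (pd p (pd i (fun v => G v j l))) u + pd q (pd p (pd j (fun v => G v i l))) u
      - pd q (pd p (pd l (fun v => G v i j))) u) := by
  have h1 := fun k i j => contDiffAt_pd (h.contDiffAt i j) k
  have h2 := fun k i j => differentiableAt_of_contDiffAt (contDiffAt_pd (h1 k i j) p)
  have h3 : pd p (gamLow G l i j) =ᶠ[𝓝 u] fun v => (1 / 2) * (pd p (pd i (fun v => G v j l)) v
      + pd p (pd j (fun v => G v i l)) v - pd p (pd l (fun v => G v i j)) v) := by
    filter_upwards [eventually_differentiableAt (h1 i j l), eventually_differentiableAt (h1 j i l),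
      eventually_differentiableAt (h1 l i j)] with v e1 e2 e3
    unfold gamLow
    rw [pd_const_mul ((e1.fun_add e2).fun_sub e3), pd_sub (e1.fun_add e2) e3, pd_add e1 e2]
  rw [pd_congr h3, pd_const_mul (((h2 _ _ _).fun_add (h2 _ _ _)).fun_sub (h2 _ _ _)),
    pd_sub ((h2 _ _ _).fun_add (h2 _ _ _)) (h2 _ _ _), pd_add (h2 _ _ _) (h2 _ _ _)]

theorem coeff_symm (i j : Fin 4) : (fun v => G v i j) = fun v => G v j i :=
  funext fun v => h.symm v i j

theorem riem_eq_pd_Gam (i j k l : Fin 4) :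
    riem G i j k l u = pd i (Gam G k j l) u - pd j (Gam G k i l) u := by
  rw [riem]
  simp [h.eq_kron, fun h => kron_comm h k, sum_kron_mul, riemUp, h.Gam_eq_zero]

theorem riem_eq (i j k l : Fin 4) : riem G i j k l u
    = curvOfHess (fun a b i j => pd a (pd b (fun v => G v i j)) u) i j k l := by
  rw [h.riem_eq_pd_Gam, h.pd_Gam, h.pd_Gam, h.pd_gamLow, h.pd_gamLow, curvOfHess,
    pd_comm (h.contDiffAt l k) i j]
  ring

theorem pd_riem (p i j k l : Fin 4) : pd p (riem G i j k l) u
    = curvOfHess (fun a b i j => pd p (pd a (pd b (fun v => G v i j))) u) i j k l := by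
  have h1 := contDiffAt_riemUp h.contDiffAt h.det_ne_zero
  have h2 := contDiffAt_Gam h.contDiffAt h.det_ne_zero
  have h3 := fun k i j => differentiableAt_of_contDiffAt (h2 k i j)
  have h4 := fun p k i j => differentiableAt_of_contDiffAt (contDiffAt_pd (h2 k i j) p)
  have e1 : pd p (riem G i j k l) u = pd p (riemUp G k i j l) u := by
    unfold riem
    rw [pd_sum fun a _ => differentiableAt_of_contDiffAt ((h.contDiffAt a k).mul (h1 a i j l))]
    simp only [pd_mul_of_pd_eq_zero (h.contDiffAt _ k) (h1 _ i j l) (h.pd_eq_zero p _ k),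
      h.eq_kron, fun a => kron_comm a k, sum_kron_mul]
  have e2 : pd p (riemUp G k i j l) u
      = pd p (pd i (Gam G k j l)) u - pd p (pd j (Gam G k i l)) u := by
    have d : ∀ a ∈ Finset.univ, DifferentiableAt ℝ (fun v => Gam G k i a v * Gam G a j l v
        - Gam G k j a v * Gam G a i l v) u := fun a _ =>
      ((h3 k i a).fun_mul (h3 a j l)).fun_sub ((h3 k j a).fun_mul (h3 a i l))
    unfold riemUp
    rw [pd_add ((h4 _ _ _ _).fun_sub (h4 _ _ _ _)) (DifferentiableAt.fun_sum d), pd_sum d,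
      pd_sub (h4 _ _ _ _) (h4 _ _ _ _)]
    simp [pd_sub ((h3 k i _).fun_mul (h3 _ j l)) ((h3 k j _).fun_mul (h3 _ i l)),
      pd_mul (h3 k _ _) (h3 _ _ l), h.Gam_eq_zero]
  rw [e1, e2, h.pd_pd_Gam, h.pd_pd_Gam, h.pd_pd_gamLow, h.pd_pd_gamLow, curvOfHess,
    pd_congr (pd_comm_eventually (h.contDiffAt l k) i j)]
  ring

theorem riem_antisymm_right (i j k l : Fin 4) : riem G i j k l u = - riem G i j l k u := by
  rw [h.riem_eq, h.riem_eq, curvOfHess_antisymm_right]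

theorem pd_riem_antisymm_left (p i j k l : Fin 4) :
    pd p (riem G i j k l) u = - pd p (riem G j i k l) u := by
  rw [h.pd_riem, h.pd_riem, curvOfHess_antisymm_left]

theorem pd_riem_antisymm_right (p i j k l : Fin 4) :
    pd p (riem G i j k l) u = - pd p (riem G i j l k) u := by
  rw [h.pd_riem, h.pd_riem, curvOfHess_antisymm_right]

theorem pd_riem_pair_symm (p i j k l : Fin 4) :
    pd p (riem G i j k l) u = pd p (riem G k l i j) u := by
  rw [h.pd_riem, h.pd_riem]
  refine curvOfHess_pair_symm (fun a b i j => ?_) (fun a b i j => ?_) i j k l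
  · exact pd_congr (pd_comm_eventually (h.contDiffAt i j) a b) p
  · simp only [h.coeff_symm i j]

/-- The second Bianchi identity. -/
theorem pd_riem_bianchi (p i j k l : Fin 4) :
    pd p (riem G i j k l) u + pd i (riem G j p k l) u + pd j (riem G p i k l) u = 0 := by
  simp only [h.pd_riem]
  exact curvOfHess_bianchi (D := fun p a b i j => pd p (pd a (pd b (fun v => G v i j))) u)
    (fun p a b i j => pd_comm (contDiffAt_pd (h.contDiffAt i j) b) p a) p i j k l

theorem ric_eq (i k : Fin 4) : ric G i k u = ∑ a, riem G i a k a u := by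
  simp only [ric, h.gInv_eq, sum_kron_mul]

theorem pd_ric (p i k : Fin 4) : pd p (ric G i k) u = ∑ a, pd p (riem G i a k a) u := by
  have h1 := contDiffAt_riem h.contDiffAt h.det_ne_zero
  have h2 := fun a b => differentiableAt_of_contDiffAt ((h.smooth_gInv a b).mul (h1 i a k b))
  unfold ric
  rw [pd_sum fun a _ => DifferentiableAt.fun_sum fun b _ => h2 a b]
  refine Finset.sum_congr rfl fun a _ => ?_
  rw [pd_sum fun b _ => h2 a b]
  simp only [pd_mul_of_pd_eq_zero (h.smooth_gInv a _) (h1 i a k _) (h.pd_gInv_eq p a _),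
    h.gInv_eq, sum_kron_mul]

theorem pd_scal (p : Fin 4) : pd p (scal G) u = ∑ b, ∑ a, pd p (riem G b a b a) u := by
  have h1 := contDiffAt_ric h.contDiffAt h.det_ne_zero
  have h2 := fun a b => differentiableAt_of_contDiffAt ((h.smooth_gInv a b).mul (h1 a b))
  unfold scal
  rw [pd_sum fun a _ => DifferentiableAt.fun_sum fun b _ => h2 a b]
  refine Finset.sum_congr rfl fun a _ => ?_
  rw [pd_sum fun b _ => h2 a b]
  simp only [pd_mul_of_pd_eq_zero (h.smooth_gInv a _) (h1 a _) (h.pd_gInv_eq p a _),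
    h.gInv_eq, sum_kron_mul, h.pd_ric]

theorem pd_weyl (p i j k l : Fin 4) : pd p (weyl G i j k l) u
    = weylPart (fun i j k l => pd p (riem G i j k l) u) i j k l := by
  have hr := contDiffAt_ric h.contDiffAt h.det_ne_zero
  have hR := contDiffAt_riem h.contDiffAt h.det_ne_zero
  have hS := contDiffAt_scal h.contDiffAt h.det_ne_zero
  have hg := h.contDiffAt
  have e : weyl G i j k l = fun v => riem G i j k l v
      - (1 / 2) * (G v j l * ric G i k v + G v i k * ric G j l v
        - G v j k * ric G i l v - G v i l * ric G j k v)
      + (1 / 6) * ((G v i k * G v j l - G v i l * G v j k) * scal G v) := by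
    funext v
    rw [weyl]
    ring
  have hgg : ∀ i j k l, pd p (fun v => G v i j * G v k l) u = 0 := fun i j k l => by
    rw [pd_mul_of_pd_eq_zero (hg i j) (hg k l) (h.pd_eq_zero p i j), h.pd_eq_zero, mul_zero]
  have dgg := fun i j k l => (hg i j).mul (hg k l)
  have hq : pd p (fun v => G v i k * G v j l - G v i l * G v j k) u = 0 := by
    rw [pd_sub (differentiableAt_of_contDiffAt (dgg _ _ _ _))
      (differentiableAt_of_contDiffAt (dgg _ _ _ _)), hgg, hgg, sub_zero]
  have dgr := fun a b c d => differentiableAt_of_contDiffAt ((hg a b).mul (hr c d))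
  have dq := ((dgg i k j l).sub (dgg i l j k))
  have d1 := ((dgr j l i k).fun_add (dgr i k j l)).fun_sub (dgr j k i l)
  have d2 := d1.fun_sub (dgr i l j k)
  have d3 := differentiableAt_of_contDiffAt (hR i j k l)
  have d4 := differentiableAt_of_contDiffAt (dq.mul hS)
  rw [e, pd_add (d3.fun_sub (d2.const_mul _)) (d4.const_mul _), pd_sub d3 (d2.const_mul _),
    pd_const_mul d2, pd_const_mul d4, pd_sub d1 (dgr _ _ _ _),
    pd_sub ((dgr _ _ _ _).fun_add (dgr _ _ _ _)) (dgr _ _ _ _), pd_add (dgr _ _ _ _) (dgr _ _ _ _),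
    pd_mul_of_pd_eq_zero dq hS hq]
  simp only [fun a b c d => pd_mul_of_pd_eq_zero (hg a b) (hr c d) (h.pd_eq_zero p a b),
    h.pd_ric, h.pd_scal, h.eq_kron, weylPart]
  ring

end IsNormalAt

/-! ### Half-harmonic Weyl curvature on a soliton, in normal coordinates -/

theorem contDiffAt_hodge {G : E4 → Matrix (Fin 4) (Fin 4) ℝ} {u : E4}
    (hG : ∀ i j, ContDiffAt ℝ ∞ (fun v => G v i j) u) (hpos : 0 < (G u).det) (s₀ : ℝ)
    (i j a b : Fin 4) : ContDiffAt ℝ ∞ (hodge G (fun _ => s₀) i j a b) u := by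
  have h1 := contDiffAt_gInv hG hpos.ne'
  have h2 : ContDiffAt ℝ ∞ (fun v => Real.sqrt (G v).det) u :=
    (contDiffAt_det hG).sqrt hpos.ne'
  unfold hodge volForm
  fun_prop

namespace IsNormalAt

variable {G : E4 → Matrix (Fin 4) (Fin 4) ℝ} {u : E4} (h : IsNormalAt G u)

include h

theorem det_pos : 0 < (G u).det := by
  rw [h.eq_one]; simp

theorem pd_det (p : Fin 4) : pd p (fun v => (G v).det) u = 0 := by
  have h0 : HasFDerivAt (fun v i j => G v i j) (0 : E4 →L[ℝ] Fin 4 → Fin 4 → ℝ) u := by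
    refine hasFDerivAt_pi'.mpr fun i => hasFDerivAt_pi'.mpr fun j => ?_
    have := (differentiableAt_of_contDiffAt (h.contDiffAt i j)).hasFDerivAt
    rw [fderiv_eq_zero_of_pd fun k => h.pd_eq_zero k i j] at this
    simpa using this
  have h1 : Differentiable ℝ fun A : Fin 4 → Fin 4 → ℝ => (Matrix.of A).det := by
    simp only [Matrix.det_apply, Matrix.of_apply]
    fun_prop
  have h2 := ((h1 _).hasFDerivAt).comp u h0
  have h3 : fderiv ℝ (fun v => (G v).det) u = 0 := by
    rw [ContinuousLinearMap.comp_zero] at h2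
    exact h2.fderiv
  rw [pd, h3]
  rfl

theorem pd_sqrt_det (p : Fin 4) : pd p (fun v => Real.sqrt (G v).det) u = 0 := by
  have h1 := differentiableAt_of_contDiffAt (contDiffAt_det h.contDiffAt)
  have h2 := h.pd_det p
  rw [pd] at h2 ⊢
  rw [fderiv_sqrt h1 h.det_ne_zero]
  simp [h2]

theorem hodge_eq (s : E4 → ℝ) (i j a b : Fin 4) :
    hodge G s i j a b u = (1 / 2) * (s u * permSymbol i j a b) := by
  simp only [hodge, volForm, h.gInv_eq, sum_mul_kron, h.eq_one, Matrix.det_one, Real.sqrt_one,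
    mul_one]

theorem pd_hodge (s₀ : ℝ) (p i j a b : Fin 4) : pd p (hodge G (fun _ => s₀) i j a b) u = 0 := by
  have h1 := h.smooth_gInv
  have h2 : ContDiffAt ℝ ∞ (fun v => Real.sqrt (G v).det) u :=
    (contDiffAt_det h.contDiffAt).sqrt h.det_ne_zero
  have h3 : ∀ c d, ContDiffAt ℝ ∞ (fun v => gInv G c a v * gInv G d b v) u :=
    fun c d => (h1 c a).mul (h1 d b)
  have h4 : ∀ c d, ContDiffAt ℝ ∞
      (fun v => Real.sqrt (G v).det * (gInv G c a v * gInv G d b v)) u :=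
    fun c d => h2.mul (h3 c d)
  have h5 := fun c d => differentiableAt_of_contDiffAt (h4 c d)
  have e : hodge G (fun _ => s₀) i j a b = fun v => ∑ c, ∑ d, ((1 / 2) * s₀ * permSymbol i j c d) *
      (Real.sqrt (G v).det * (gInv G c a v * gInv G d b v)) := by
    funext v
    simp only [hodge, volForm, Finset.mul_sum]
    exact Finset.sum_congr rfl fun c _ => Finset.sum_congr rfl fun d _ => by ring
  rw [e, pd_sum fun c _ => DifferentiableAt.fun_sum fun d _ => (h5 c d).const_mul _]
  refine Finset.sum_eq_zero fun c _ => ?_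
  rw [pd_sum fun d _ => (h5 c d).const_mul _]
  refine Finset.sum_eq_zero fun d _ => ?_
  rw [pd_const_mul (h5 c d), pd_mul_of_pd_eq_zero h2 (h3 c d) (h.pd_sqrt_det p),
    pd_mul_of_pd_eq_zero (h1 c a) (h1 d b) (h.pd_gInv_eq p c a), h.pd_gInv_eq]
  ring

theorem pd_hodge_mul (s₀ : ℝ) (p i j a b : Fin 4) {B : E4 → ℝ} (hB : ContDiffAt ℝ ∞ B u) :
    pd p (fun v => hodge G (fun _ => s₀) i j a b v * B v) u
      = (1 / 2) * (s₀ * permSymbol i j a b) * pd p B u := by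
  rw [pd_mul_of_pd_eq_zero (contDiffAt_hodge h.contDiffAt h.det_pos s₀ i j a b) hB
    (h.pd_hodge s₀ p i j a b), h.hodge_eq]

/-- The first derivatives of `W^±` are the (anti-)self-dual parts of those of `W`. -/
theorem pd_halfWeyl (s₀ σ : ℝ) (p i j k l : Fin 4) :
    pd p (halfWeyl G (fun _ => s₀) σ i j k l) u
      = (1 / 4) * (pd p (weyl G i j k l) u
        + σ * s₀ * hodgeStar (fun a b => pd p (weyl G i j a b) u) k l
        + σ * s₀ * hodgeStar (fun a b => pd p (weyl G a b k l) u) i j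
        + s₀ ^ 2 * hodgeStar (fun a b => hodgeStar (fun c d => pd p (weyl G a b c d) u) k l)
          i j) := by
  have hW := contDiffAt_weyl h.contDiffAt h.det_ne_zero
  have hH := contDiffAt_hodge h.contDiffAt h.det_pos s₀
  have hHW := fun i j a b a' b' c d => (hH i j a b).mul (hW a' b' c d)
  have d0 := differentiableAt_of_contDiffAt (hW i j k l)
  have d1 := fun a b => differentiableAt_of_contDiffAt (hHW k l a b i j a b)
  have d2 := fun a b => differentiableAt_of_contDiffAt (hHW i j a b a b k l)
  have d3 := fun a b c d => differentiableAt_of_contDiffAt ((hH i j a b).mul (hHW k l c d a b c d))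
  have s1 := DifferentiableAt.fun_sum fun a (_ : a ∈ Finset.univ) =>
    DifferentiableAt.fun_sum fun b (_ : b ∈ Finset.univ) => d1 a b
  have s2 := DifferentiableAt.fun_sum fun a (_ : a ∈ Finset.univ) =>
    DifferentiableAt.fun_sum fun b (_ : b ∈ Finset.univ) => d2 a b
  have s3c := fun a b c => DifferentiableAt.fun_sum fun d (_ : d ∈ Finset.univ) => d3 a b c d
  have s3b := fun a b => DifferentiableAt.fun_sum fun c (_ : c ∈ Finset.univ) => s3c a b c
  have s3a := fun a => DifferentiableAt.fun_sum fun b (_ : b ∈ Finset.univ) => s3b a b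
  have s3 := DifferentiableAt.fun_sum fun a (_ : a ∈ Finset.univ) => s3a a
  have e : halfWeyl G (fun _ => s₀) σ i j k l = fun v => (1 / 4) * (weyl G i j k l v
      + σ * (∑ a, ∑ b, hodge G (fun _ => s₀) k l a b v * weyl G i j a b v)
      + σ * (∑ a, ∑ b, hodge G (fun _ => s₀) i j a b v * weyl G a b k l v)
      + ∑ a, ∑ b, ∑ c, ∑ d, hodge G (fun _ => s₀) i j a b v *
        (hodge G (fun _ => s₀) k l c d v * weyl G a b c d v)) := by
    funext v
    simp only [halfWeyl, mul_assoc]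
  have e1 : pd p (fun v => ∑ a, ∑ b, hodge G (fun _ => s₀) k l a b v * weyl G i j a b v) u
      = s₀ * hodgeStar (fun a b => pd p (weyl G i j a b) u) k l := by
    rw [pd_sum fun a _ => DifferentiableAt.fun_sum fun b _ => d1 a b]
    simp only [pd_sum fun b _ => d1 _ b, h.pd_hodge_mul s₀ p k l _ _ (hW i j _ _), hodgeStar,
      Finset.mul_sum]
    exact Finset.sum_congr rfl fun a _ => Finset.sum_congr rfl fun b _ => by ring
  have e2 : pd p (fun v => ∑ a, ∑ b, hodge G (fun _ => s₀) i j a b v * weyl G a b k l v) u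
      = s₀ * hodgeStar (fun a b => pd p (weyl G a b k l) u) i j := by
    rw [pd_sum fun a _ => DifferentiableAt.fun_sum fun b _ => d2 a b]
    simp only [pd_sum fun b _ => d2 _ b, h.pd_hodge_mul s₀ p i j _ _ (hW _ _ k l), hodgeStar,
      Finset.mul_sum]
    exact Finset.sum_congr rfl fun a _ => Finset.sum_congr rfl fun b _ => by ring
  have e3 : pd p (fun v => ∑ a, ∑ b, ∑ c, ∑ d, hodge G (fun _ => s₀) i j a b v *
        (hodge G (fun _ => s₀) k l c d v * weyl G a b c d v)) u
      = s₀ ^ 2 * hodgeStar (fun a b => hodgeStar (fun c d => pd p (weyl G a b c d) u) k l) i j := by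
    rw [pd_sum fun a _ => s3a a]
    simp only [pd_sum fun b _ => s3b _ b, pd_sum fun c _ => s3c _ _ c,
      pd_sum fun d _ => d3 _ _ _ d, h.pd_hodge_mul s₀ p i j _ _ (hHW k l _ _ _ _ _ _),
      h.pd_hodge_mul s₀ p k l _ _ (hW _ _ _ _), hodgeStar, Finset.mul_sum]
    exact Finset.sum_congr rfl fun a _ => Finset.sum_congr rfl fun b _ =>
      Finset.sum_congr rfl fun c _ => Finset.sum_congr rfl fun d _ => by ring
  rw [e, pd_const_mul (((d0.fun_add (s1.const_mul σ)).fun_add (s2.const_mul σ)).fun_add s3),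
    pd_add ((d0.fun_add (s1.const_mul σ)).fun_add (s2.const_mul σ)) s3,
    pd_add (d0.fun_add (s1.const_mul σ)) (s2.const_mul σ), pd_add d0 (s1.const_mul σ),
    pd_const_mul s1, pd_const_mul s2, e1, e2, e3]
  ring

/-- Since the star acting on the first pair of indices of `∇W` can be moved to the second pair,
`δW^±` is a combination of `δW` and of its dual in the free pair of indices. As `hodgeStar` is
the star of the orientation given by the coordinate frame, `s u = ±1` times it is the star of the
given orientation, and the formula reads `2 δW^± = δW ± ⋆δW`. -/
theorem four_mul_div_halfWeyl {s : E4 → ℝ} (hs : ∀ᶠ v in 𝓝 u, s v = s u) (σ : ℝ)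
    (j k l : Fin 4) :
    4 * div4 G (halfWeyl G s σ) j k l u = (1 + s u ^ 2) * ∑ i, pd i (weyl G i j k l) u
      + 2 * σ * s u * hodgeStar (fun a b => ∑ i, pd i (weyl G i j a b) u) k l := by
  have hc : ∀ i j k l, pd i (halfWeyl G s σ i j k l) u
      = pd i (halfWeyl G (fun _ => s u) σ i j k l) u := by
    intro i j k l
    refine pd_congr (hs.mono fun v hv => ?_) i
    simp only [halfWeyl, hodge, volForm, hv]
  have hd : div4 G (halfWeyl G s σ) j k l u
      = ∑ i, pd i (halfWeyl G (fun _ => s u) σ i j k l) u := by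
    simp only [div4, h.gInv_eq, sum_kron_mul, covDeriv4, h.Gam_eq_zero, zero_mul, add_zero,
      Finset.sum_const_zero, sub_zero, hc]
  have w12 : ∀ p i j k l, pd p (weyl G i j k l) u = - pd p (weyl G j i k l) u :=
    fun p i j k l => by
      rw [h.pd_weyl, h.pd_weyl, weylPart_antisymm_left (h.pd_riem_antisymm_left p)]
  have w34 : ∀ p i j k l, pd p (weyl G i j k l) u = - pd p (weyl G i j l k) u :=
    fun p i j k l => by
      rw [h.pd_weyl, h.pd_weyl, weylPart_antisymm_right (h.pd_riem_antisymm_right p)]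
  have wp : ∀ p i j k l, pd p (weyl G i j k l) u = pd p (weyl G k l i j) u :=
    fun p i j k l => by rw [h.pd_weyl, h.pd_weyl, weylPart_pair_symm (h.pd_riem_pair_symm p)]
  have wt : ∀ p j l, ∑ i, pd p (weyl G i j i l) u = 0 := fun p j l => by
    simp only [h.pd_weyl,
      weylPart_trace (h.pd_riem_antisymm_left p) (h.pd_riem_antisymm_right p)]
  have c := fun p i j k l => hodgeStar_comm (V := fun i j k l => pd p (weyl G i j k l) u)
    (w12 p) (w34 p) (wp p) (wt p) i j k l
  have hi : ∀ i, 4 * pd i (halfWeyl G (fun _ => s u) σ i j k l) u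
      = (1 + s u ^ 2) * pd i (weyl G i j k l) u
        + 2 * σ * s u * hodgeStar (fun a b => pd i (weyl G i j a b) u) k l := by
    intro i
    have e : hodgeStar (fun a b => hodgeStar (fun c d => pd i (weyl G a b c d) u) k l) i j
        = pd i (weyl G i j k l) u := by
      simp only [← c]
      exact hodgeStar_hodgeStar (η := fun a b => pd i (weyl G a b k l) u)
        (fun a b => w12 i a b k l) i j
    rw [h.pd_halfWeyl, e, c]
    ring
  rw [hd, hodgeStar_sum, Finset.mul_sum, Finset.mul_sum, Finset.mul_sum, ← Finset.sum_add_distrib]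
  exact Finset.sum_congr rfl fun i _ => hi i

/-- On a gradient Ricci soliton with half-harmonic Weyl curvature, `d|∇F|² ∧ dF = 0`: contracting
the Cotton tensor with `∇F` gives a multiple of the decomposable two-form `dR ∧ dF`, which has to be
(anti-)self-dual. -/
theorem pd_gradSq_wedge {s F : E4 → ℝ} {c σ : ℝ} (hs : ∀ᶠ v in 𝓝 u, s v = s u)
    (hF : ContDiffAt ℝ ∞ F u)
    (hsol : ∀ᶠ v in 𝓝 u, ∀ i j, ric G i j v + hess G F i j v = c * G v i j)
    (hW : ∀ j k l, div4 G (halfWeyl G s σ) j k l u = 0) (k l : Fin 4) :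
    pd k (gradSq G F) u * pd l F u = pd l (gradSq G F) u * pd k F u := by
  have hΓ := contDiffAt_Gam h.contDiffAt h.det_ne_zero
  have hF1 := contDiffAt_pd hF
  -- the derivative of the soliton equation, whose skew part in `k`, `l` is the Ricci identity
  have hD : ∀ k l j, pd k (ric G l j) u
      = - (pd k (pd l (pd j F)) u - ∑ m, pd k (Gam G m l j) u * pd m F u) := by
    intro k l j
    have d1 := differentiableAt_of_contDiffAt (contDiffAt_pd (hF1 j) l)
    have d2 : ∀ m, DifferentiableAt ℝ (fun v => Gam G m l j v * pd m F v) u := fun m =>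
      differentiableAt_of_contDiffAt ((hΓ m l j).mul (hF1 m))
    have e1 : ric G l j =ᶠ[𝓝 u] fun v => c * G v l j - hess G F l j v := by
      filter_upwards [hsol] with v hv
      linarith [hv l j]
    have dh : DifferentiableAt ℝ (hess G F l j) u := by
      unfold hess
      exact d1.fun_sub (DifferentiableAt.fun_sum fun m _ => d2 m)
    have dg := differentiableAt_of_contDiffAt (h.contDiffAt l j)
    have e2 : pd k (hess G F l j) u
        = pd k (pd l (pd j F)) u - ∑ m, pd k (Gam G m l j) u * pd m F u := by
      unfold hess
      rw [pd_sub d1 (DifferentiableAt.fun_sum fun m _ => d2 m), pd_sum fun m _ => d2 m]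
      congr 1
      refine Finset.sum_congr rfl fun m _ => ?_
      rw [pd_mul (differentiableAt_of_contDiffAt (hΓ m l j))
        (differentiableAt_of_contDiffAt (hF1 m)), h.Gam_eq_zero]
      ring
    rw [pd_congr e1, pd_sub (dg.const_mul c) dh, pd_const_mul dg, h.pd_eq_zero, e2]
    ring
  have hC : ∀ k l j, pd k (ric G l j) u - pd l (ric G k j) u
      = ∑ m, riem G k l m j u * pd m F u := by
    intro k l j
    rw [hD, hD, pd_comm (hF1 j) k l]
    simp only [h.riem_eq_pd_Gam, sub_mul, Finset.sum_sub_distrib]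
    ring
  -- tracing gives `∇_k R = 2 R_{km} ∇^m F`
  have hscal : ∀ k, pd k (scal G) u = 2 * ∑ m, ric G k m u * pd m F u := by
    intro k
    have e1 : ∑ l, pd k (ric G l l) u = pd k (scal G) u := by
      rw [h.pd_scal]
      exact Finset.sum_congr rfl fun l _ => h.pd_ric k l l
    have e2 : ∑ l, pd l (ric G k l) u = (1 / 2) * pd k (scal G) u := by
      rw [h.pd_scal, ← div_ric h.pd_riem_antisymm_left h.pd_riem_antisymm_right
        h.pd_riem_pair_symm h.pd_riem_bianchi k]
      refine Finset.sum_congr rfl fun l _ => ?_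
      rw [h.pd_ric]
      exact Finset.sum_congr rfl fun a _ => h.pd_riem_pair_symm _ _ _ _ _
    have e3 : ∑ l, (pd k (ric G l l) u - pd l (ric G k l) u)
        = ∑ m, ric G k m u * pd m F u := by
      simp only [hC, h.ric_eq, Finset.sum_mul]
      exact Finset.sum_comm
    rw [Finset.sum_sub_distrib, e1, e2] at e3
    linarith
  -- `R_{klmj}` is skew in `m`, `j`, so only the traces in the Cotton tensor survive the
  -- contraction with `∇F`
  have hCF : ∀ k l, ∑ j, (pd k (ric G l j) u - pd l (ric G k j) u) * pd j F u = 0 := by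
    intro k l
    have e : ∑ j, (pd k (ric G l j) u - pd l (ric G k j) u) * pd j F u
        = - ∑ j, (pd k (ric G l j) u - pd l (ric G k j) u) * pd j F u := by
      simp only [hC, Finset.sum_mul]
      conv_lhs => rw [Finset.sum_comm]
      rw [← Finset.sum_neg_distrib]
      refine Finset.sum_congr rfl fun m _ => ?_
      rw [← Finset.sum_neg_distrib]
      refine Finset.sum_congr rfl fun j _ => ?_
      rw [h.riem_antisymm_right k l m j]
      ring
    linarith
  have hY : ∀ k l, ∑ j, pd j F u * ∑ i, pd i (weyl G i j k l) u
      = - (1 / 12) * (pd k (scal G) u * pd l F u - pd l (scal G) u * pd k F u) := by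
    intro k l
    have e : ∀ j, pd j F u * ∑ i, pd i (weyl G i j k l) u
        = (1 / 2) * ((pd k (ric G l j) u - pd l (ric G k j) u) * pd j F u)
          - (1 / 12) * (pd k (scal G) u * (kron l j * pd j F u)
            - pd l (scal G) u * (kron k j * pd j F u)) := by
      intro j
      have := two_mul_div_weylPart h.pd_riem_antisymm_left h.pd_riem_antisymm_right
        h.pd_riem_pair_symm h.pd_riem_bianchi j k l
      simp only [← h.pd_scal, ← h.pd_weyl] at this
      simp only [← h.pd_ric] at this
      rw [kron_comm l j, kron_comm k j]
      linear_combination (1 / 2) * pd j F u * this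
    simp only [e, Finset.sum_sub_distrib, ← Finset.mul_sum, hCF, sum_kron_mul]
    ring
  have hwedge : ∀ k l, pd k (scal G) u * pd l F u = pd l (scal G) u * pd k F u := by
    refine wedge_eq_zero (x := fun k => pd k (scal G) u) (y := fun k => pd k F u)
      (r := 1 + s u ^ 2) (t := - (2 * σ * s u)) (by positivity) fun k l => ?_
    have e1 : ∑ j, pd j F u * ((1 + s u ^ 2) * ∑ i, pd i (weyl G i j k l) u
        + 2 * σ * s u * hodgeStar (fun a b => ∑ i, pd i (weyl G i j a b) u) k l) = 0 :=
      Finset.sum_eq_zero fun j _ => by rw [← h.four_mul_div_halfWeyl hs σ j k l, hW]; ring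
    have e2 : ∑ j, pd j F u * hodgeStar (fun a b => ∑ i, pd i (weyl G i j a b) u) k l
        = - (1 / 12) * hodgeStar (fun a b => pd a (scal G) u * pd b F u
          - pd b (scal G) u * pd a F u) k l := by
      simp only [← hodgeStar_const_mul, ← hodgeStar_sum, hY]
    have e3 : (1 + s u ^ 2) * ∑ j, pd j F u * ∑ i, pd i (weyl G i j k l) u
        + 2 * σ * s u * ∑ j, pd j F u * hodgeStar (fun a b => ∑ i, pd i (weyl G i j a b) u) k l
        = 0 := by
      rw [← e1, Finset.mul_sum, Finset.mul_sum, ← Finset.sum_add_distrib]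
      exact Finset.sum_congr rfl fun j _ => by ring
    rw [e2, hY] at e3
    linear_combination -12 * e3
  have hgrad : ∀ m, grad G F u m = pd m F u := fun m => by
    simp only [grad, h.gInv_eq, sum_kron_mul]
  have hN : ∀ k, pd k (gradSq G F) u = 2 * c * pd k F u - pd k (scal G) u := by
    intro k
    have hh : ∀ m, hess G F k m u = c * kron k m - ric G k m u := fun m => by
      have := hsol.self_of_nhds k m
      rw [h.eq_kron] at this
      linarith
    rw [pd_gradSq h.contDiffAt h.det_ne_zero h.symm hF, hscal]
    simp only [hgrad, hh, sub_mul, Finset.sum_sub_distrib, mul_assoc, ← Finset.mul_sum,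
      sum_kron_mul]
    ring
  rw [hN, hN]
  linear_combination - hwedge k l

end IsNormalAt

/-! ### Changes of charts -/

theorem pd_apply {τ : E4 → E4} {x : E4} (hτ : DifferentiableAt ℝ τ x) (i a : Fin 4) :
    pd i (fun y => τ y a) x = (fderiv ℝ τ x (EuclideanSpace.single i 1)) a := by
  have h : fderiv ℝ (fun y => τ y a) x = (EuclideanSpace.proj (𝕜 := ℝ) a).comp (fderiv ℝ τ x) :=
    ((EuclideanSpace.proj (𝕜 := ℝ) a).hasFDerivAt.comp x hτ.hasFDerivAt).fderiv
  rw [pd, h]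
  rfl

theorem pd_comp {τ : E4 → E4} {F : E4 → ℝ} {x : E4} (hτ : DifferentiableAt ℝ τ x)
    (hF : DifferentiableAt ℝ F (τ x)) (i : Fin 4) :
    pd i (fun y => F (τ y)) x = ∑ a, pd i (fun y => τ y a) x * pd a F (τ x) := by
  have h : fderiv ℝ (fun y => F (τ y)) x = (fderiv ℝ F (τ x)).comp (fderiv ℝ τ x) :=
    (hF.hasFDerivAt.comp x hτ.hasFDerivAt).fderiv
  rw [pd, h, ContinuousLinearMap.comp_apply, fderiv_eq_sum_pd]
  simp only [pd_apply hτ]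

section Chart

variable {M : Type*} [TopologicalSpace M] [ChartedSpace E4 M]

theorem mfderiv_symm_injective {φ : OpenPartialHomeomorph M E4}
    (hφ : φ ∈ IsManifold.maximalAtlas (𝓡 4) ∞ M) {u : E4} (hu : u ∈ φ.target) :
    Function.Injective (mfderiv (𝓡 4) (𝓡 4) φ.symm u) := by
  have h : φ.MDifferentiable (𝓡 4) (𝓡 4) :=
    ⟨(contMDiffOn_of_mem_maximalAtlas hφ).mdifferentiableOn (by simp),
      (contMDiffOn_symm_of_mem_maximalAtlas hφ).mdifferentiableOn (by simp)⟩
  exact h.symm.mfderiv_injective hu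

theorem coordVec_sum {φ : OpenPartialHomeomorph M E4} (u x : E4) :
    ∑ i, x i • coordVec φ u i = mfderiv (𝓡 4) (𝓡 4) φ.symm u x := by
  have hx : x = ∑ i, x i • (EuclideanSpace.single i (1 : ℝ) : E4) := by
    ext j
    simp [Pi.single_apply]
  conv_rhs => rw [hx]
  refine Eq.symm ((map_sum (mfderiv (𝓡 4) (𝓡 4) φ.symm u) _ _).trans ?_)
  refine Finset.sum_congr rfl fun i _ => ?_
  exact (mfderiv (𝓡 4) (𝓡 4) φ.symm u).map_smul _ _

variable [IsManifold (𝓡 4) ∞ M]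

/-- A chart around `p` can be composed with the inverse of a smooth map `τ` that is a local
diffeomorphism at `0` and sends `0` to the coordinates of `p`. -/
theorem exists_chart_comp {φ : OpenPartialHomeomorph M E4}
    (hφ : φ ∈ IsManifold.maximalAtlas (𝓡 4) ∞ M) {p : M} (hp : p ∈ φ.source) {τ : E4 → E4}
    (hτ : ContDiff ℝ ∞ τ) (hτ0 : τ 0 = φ p) {A : E4 ≃L[ℝ] E4}
    (hA : HasFDerivAt τ (A : E4 →L[ℝ] E4) 0) :
    ∃ ψ ∈ IsManifold.maximalAtlas (𝓡 4) ∞ M, (0 : E4) ∈ ψ.target ∧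
      ∀ x ∈ ψ.target, τ x ∈ φ.target ∧ ψ.symm x = φ.symm (τ x) := by
  have hn : (∞ : ℕ∞ω) ≠ 0 := by simp
  set e₀ := hτ.contDiffAt.toOpenPartialHomeomorph τ hA hn with he₀
  have he₀c : (e₀ : E4 → E4) = τ := hτ.contDiffAt.toOpenPartialHomeomorph_coe hA hn
  -- the open set where the derivative of `τ` is invertible
  set U : Set E4 := fderiv ℝ τ ⁻¹' Set.range ((↑) : (E4 ≃L[ℝ] E4) → E4 →L[ℝ] E4) with hU
  have hUo : IsOpen U :=
    (ContinuousLinearEquiv.isOpen (𝕜 := ℝ) (E := E4) (F := E4)).preimage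
      (hτ.continuous_fderiv hn)
  set e := e₀.restrOpen U hUo with he
  have hec : (e : E4 → E4) = τ := by rw [← he₀c]; rfl
  have hes : ContDiffOn ℝ ∞ e.symm e.target := by
    intro y hy
    have hx : e.symm y ∈ e.source := e.map_target hy
    have hxU : e.symm y ∈ U := by
      rw [he, OpenPartialHomeomorph.restrOpen_source] at hx
      exact hx.2
    obtain ⟨B, hB⟩ := hxU
    refine (e.contDiffAt_symm (f₀' := B) hy ?_ ?_).contDiffWithinAt
    · rw [hB, hec]
      exact (hτ.differentiable (by simp) _).hasFDerivAt
    · rw [hec]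
      exact hτ.contDiffAt
  have h0 : (0 : E4) ∈ e.source := by
    rw [he, OpenPartialHomeomorph.restrOpen_source]
    refine ⟨hτ.contDiffAt.mem_toOpenPartialHomeomorph_source hA hn, ?_⟩
    exact ⟨A, hA.fderiv.symm⟩
  refine ⟨φ.trans e.symm, ?_, ?_, ?_⟩
  · refine OpenPartialHomeomorph.mem_maximalAtlas_of_contMDiffOn _ ?_ ?_
    · have h1 : ContMDiffOn (𝓡 4) (𝓡 4) ∞ e.symm e.target := contMDiffOn_iff_contDiffOn.mpr hes
      rw [OpenPartialHomeomorph.coe_trans]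
      refine h1.comp ((contMDiffOn_of_mem_maximalAtlas hφ).mono ?_) ?_
      · rw [OpenPartialHomeomorph.trans_source]; exact Set.inter_subset_left
      · rw [OpenPartialHomeomorph.trans_source]; exact Set.inter_subset_right
    · have h1 : ContMDiff (𝓡 4) (𝓡 4) ∞ e := by
        rw [hec]; exact contMDiff_iff_contDiff.mpr hτ
      rw [OpenPartialHomeomorph.coe_trans_symm]
      refine (contMDiffOn_symm_of_mem_maximalAtlas hφ).comp h1.contMDiffOn ?_
      rw [OpenPartialHomeomorph.trans_target]
      exact Set.inter_subset_right
  · rw [OpenPartialHomeomorph.trans_target]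
    refine ⟨h0, ?_⟩
    change e 0 ∈ φ.target
    rw [hec, hτ0]
    exact φ.map_source hp
  · intro x hx
    rw [OpenPartialHomeomorph.trans_target] at hx
    have h2 : e x ∈ φ.target := hx.2
    rw [hec] at h2
    refine ⟨h2, ?_⟩
    change φ.symm (e x) = _
    rw [hec]

variable (g : Metric M)

theorem coeff_symm (φ : OpenPartialHomeomorph M E4) (u : E4) (i j : Fin 4) :
    g.coeff φ u i j = g.coeff φ u j i :=
  g.symm _ _ _

theorem sum_coeff (φ : OpenPartialHomeomorph M E4) (u x y : E4) :
    ∑ i, ∑ j, x i * y j * g.coeff φ u i j = g.inner (φ.symm u)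
      (mfderiv (𝓡 4) (𝓡 4) φ.symm u x) (mfderiv (𝓡 4) (𝓡 4) φ.symm u y) := by
  rw [← coordVec_sum, ← coordVec_sum]
  simp only [map_sum, sum_apply, map_smul, smul_apply, smul_eq_mul, Metric.coeff,
    Matrix.of_apply, Finset.mul_sum]
  rw [Finset.sum_comm]
  exact Finset.sum_congr rfl fun i _ => Finset.sum_congr rfl fun j _ => by ring

theorem posDef_coeff {φ : OpenPartialHomeomorph M E4}
    (hφ : φ ∈ IsManifold.maximalAtlas (𝓡 4) ∞ M) {u : E4} (hu : u ∈ φ.target) :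
    (g.coeff φ u).PosDef := by
  refine Matrix.PosDef.of_dotProduct_mulVec_pos ?_ ?_
  · ext i j
    simp [coeff_symm g φ u j i]
  · intro x hx
    have h1 : star x ⬝ᵥ (g.coeff φ u *ᵥ x)
        = ∑ i, ∑ j, (WithLp.toLp 2 x : E4) i * (WithLp.toLp 2 x : E4) j * g.coeff φ u i j := by
      simp only [dotProduct, Matrix.mulVec, Finset.mul_sum, Pi.star_apply, star_trivial]
      exact Finset.sum_congr rfl fun i _ => Finset.sum_congr rfl fun j _ => by ring
    rw [h1, sum_coeff]
    refine g.pos _ _ fun h0 => hx ?_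
    have h2 : (WithLp.toLp 2 x : E4) = 0 :=
      mfderiv_symm_injective hφ hu (h0.trans (map_zero _).symm)
    simpa using congrArg WithLp.ofLp h2

theorem contDiffAt_coeff {φ : OpenPartialHomeomorph M E4}
    (hφ : φ ∈ IsManifold.maximalAtlas (𝓡 4) ∞ M) {u : E4} (hu : u ∈ φ.target) (i j : Fin 4) :
    ContDiffAt ℝ ∞ (fun v => g.coeff φ v i j) u := by
  have hs := contMDiffAt_symm_of_mem_maximalAtlas hφ hu
  have hv : ∀ i, ContMDiffAt (𝓡 4) ((𝓡 4).prod 𝓘(ℝ, E4)) ∞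
      (fun v => (Bundle.TotalSpace.mk' E4 (φ.symm v) (coordVec φ v i) : TangentBundle (𝓡 4) M))
      u := by
    intro i
    have hc : ContMDiffAt (𝓡 4) ((𝓡 4).prod 𝓘(ℝ, E4)) ∞
        (fun v : E4 => (Bundle.TotalSpace.mk' E4 v (EuclideanSpace.single i (1 : ℝ) : E4) :
          TangentBundle (𝓡 4) E4)) u :=
      contMDiffAt_vectorSpace_iff_contDiffAt.mpr contDiffAt_const
    exact ContMDiffAt.clm_apply_of_inCoordinates (hs.mfderiv_const (m := ∞) (by simp)) hc hs
  have hg : ContMDiffAt (𝓡 4) ((𝓡 4).prod 𝓘(ℝ, E4 →L[ℝ] E4 →L[ℝ] ℝ)) ∞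
      (fun v => Bundle.TotalSpace.mk' (E4 →L[ℝ] E4 →L[ℝ] ℝ)
        (E := fun p : M => TangentSpace (𝓡 4) p →L[ℝ] TangentSpace (𝓡 4) p →L[ℝ] ℝ)
        (φ.symm v) (g.inner (φ.symm v))) u :=
    (g.contMDiff _).comp u hs
  have h := ContMDiffAt.clm_bundle_apply₂ (F₁ := E4) (F₂ := E4) (F₃ := ℝ)
    (E₃ := Bundle.Trivial M ℝ) hg (hv i) (hv j)
  exact contMDiffAt_iff_contDiffAt.mp (Bundle.contMDiffAt_totalSpace.mp h).2

/-- The transformation law of the metric coefficients. -/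
theorem coeff_comp {φ ψ : OpenPartialHomeomorph M E4}
    (hφ : φ ∈ IsManifold.maximalAtlas (𝓡 4) ∞ M)
    {τ : E4 → E4} (hτ : ContDiff ℝ ∞ τ)
    (h : ∀ x ∈ ψ.target, τ x ∈ φ.target ∧ ψ.symm x = φ.symm (τ x)) {x : E4} (hx : x ∈ ψ.target)
    (i j : Fin 4) : g.coeff ψ x i j = ∑ a, ∑ b, pd i (fun y => τ y a) x * pd j (fun y => τ y b) x
      * g.coeff φ (τ x) a b := by
  have dτ : DifferentiableAt ℝ τ x := hτ.differentiable (by simp) x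
  have hφd : MDifferentiableAt (𝓡 4) (𝓡 4) φ.symm (τ x) :=
    (contMDiffAt_symm_of_mem_maximalAtlas hφ (h x hx).1).mdifferentiableAt (by simp)
  have hc : HasMFDerivAt (𝓡 4) (𝓡 4) (φ.symm ∘ τ) x
      ((mfderiv (𝓡 4) (𝓡 4) φ.symm (τ x)).comp (fderiv ℝ τ x)) :=
    HasMFDerivAt.comp x hφd.hasMFDerivAt dτ.hasFDerivAt.hasMFDerivAt
  have he : ψ.symm =ᶠ[𝓝 x] φ.symm ∘ τ :=
    (ψ.open_target.mem_nhds hx |> fun hU => Filter.mem_of_superset hU fun y hy => (h y hy).2)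
  have hd := (hc.congr_of_eventuallyEq he).mfderiv
  have hv : ∀ i, (coordVec ψ x i : E4)
      = mfderiv (𝓡 4) (𝓡 4) φ.symm (τ x) (fderiv ℝ τ x (EuclideanSpace.single i 1)) := by
    intro i
    unfold coordVec
    rw [hd]
    rfl
  have hb : ∀ (q q' : M) (_ : q = q') (v w : E4),
      g.inner q (v : TangentSpace (𝓡 4) q) (w : TangentSpace (𝓡 4) q)
        = g.inner q' (v : TangentSpace (𝓡 4) q') (w : TangentSpace (𝓡 4) q') := by
    rintro q _ rfl v w
    rfl
  simp only [pd_apply dτ]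
  rw [sum_coeff, Metric.coeff, Matrix.of_apply]
  refine (hb _ _ (h x hx).2 _ _).trans ?_
  rw [hv, hv]

end Chart

/-! ### Existence of normal coordinates -/

open scoped MatrixOrder in
theorem exists_orthonormal_frame {g : Matrix (Fin 4) (Fin 4) ℝ} (hg : g.PosDef) :
    ∃ A : Matrix (Fin 4) (Fin 4) ℝ, IsUnit A.det ∧ Aᵀ * g * A = 1 := by
  obtain ⟨B, hB⟩ := CStarAlgebra.nonneg_iff_eq_star_mul_self.mp hg.posSemidef.nonneg
  have hB' : g = Bᵀ * B := by
    rw [hB, Matrix.star_eq_conjTranspose, Matrix.conjTranspose_eq_transpose_of_trivial]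
  have hBd : IsUnit B.det := by
    rw [isUnit_iff_ne_zero]
    intro h0
    have := hg.det_pos
    rw [hB', Matrix.det_mul, h0, mul_zero] at this
    exact this.false
  refine ⟨B⁻¹, Matrix.isUnit_nonsing_inv_det B hBd, ?_⟩
  rw [hB', Matrix.transpose_nonsing_inv, ← Matrix.mul_assoc,
    Matrix.nonsing_inv_mul _ (by simpa using hBd), Matrix.one_mul, Matrix.mul_nonsing_inv _ hBd]

theorem pd_coord (k i : Fin 4) (x : E4) : pd k (fun y : E4 => y i) x = kron k i := by
  rw [pd_apply (τ := fun y => y) differentiableAt_id, fderiv_fun_id]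
  simp [kron, eq_comm]

/-- The quadratic map with value `u₀`, derivative `A` and second derivative `- Q` at `0`. -/
def quadMap (u₀ : E4) (A : Matrix (Fin 4) (Fin 4) ℝ) (Q : Fin 4 → Fin 4 → Fin 4 → ℝ) (x : E4) :
    E4 :=
  WithLp.toLp 2 fun a => u₀ a + ∑ i, A a i * x i - (1 / 2) * ∑ i, ∑ j, Q a i j * (x i * x j)

section QuadMap

variable {u₀ : E4} {A : Matrix (Fin 4) (Fin 4) ℝ} {Q : Fin 4 → Fin 4 → Fin 4 → ℝ}

theorem quadMap_apply (x : E4) (a : Fin 4) : quadMap u₀ A Q x a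
    = u₀ a + ∑ i, A a i * x i - (1 / 2) * ∑ i, ∑ j, Q a i j * (x i * x j) := rfl

theorem contDiff_quadMap : ContDiff ℝ ∞ (quadMap u₀ A Q) := by
  rw [contDiff_piLp]
  intro a
  simp only [quadMap_apply]
  fun_prop

theorem quadMap_zero : quadMap u₀ A Q 0 = u₀ := by
  ext a
  simp [quadMap_apply]

theorem pd_quadMap (hQ : ∀ a i j, Q a i j = Q a j i) (x : E4) (k a : Fin 4) :
    pd k (fun y => quadMap u₀ A Q y a) x = A a k - ∑ j, Q a k j * x j := by
  have d : ∀ i, DifferentiableAt ℝ (fun y : E4 => y i) x := fun i => by fun_prop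
  have d1 : DifferentiableAt ℝ (fun y : E4 => ∑ i, A a i * y i) x := by fun_prop
  have d2 : ∀ i, DifferentiableAt ℝ (fun y : E4 => ∑ j, Q a i j * (y i * y j)) x :=
    fun i => by fun_prop
  have d3 : DifferentiableAt ℝ (fun y : E4 => ∑ i, ∑ j, Q a i j * (y i * y j)) x := by fun_prop
  simp only [quadMap_apply]
  rw [pd_sub ((differentiableAt_const _).fun_add d1) (d3.const_mul _),
    pd_add (differentiableAt_const _) d1, pd_const, pd_const_mul d3,
    pd_sum fun i _ => (d i).const_mul _, pd_sum fun i _ => d2 i]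
  simp only [pd_const_mul (d _),
    pd_sum (s := Finset.univ) fun j _ => ((d _).fun_mul (d j)).const_mul (Q a _ j),
    pd_const_mul ((d _).fun_mul (d _)), pd_mul (d _) (d _), pd_coord, mul_add,
    Finset.sum_add_distrib]
  have e1 : ∑ i, ∑ j, Q a i j * (kron k i * x j) = ∑ j, Q a k j * x j := by
    rw [Finset.sum_comm]
    refine Finset.sum_congr rfl fun j _ => ?_
    rw [← sum_kron_mul (fun i => Q a i j * x j) k]
    exact Finset.sum_congr rfl fun i _ => by ring
  have e2 : ∑ i, ∑ j, Q a i j * (x i * kron k j) = ∑ j, Q a k j * x j := by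
    refine Finset.sum_congr rfl fun i _ => ?_
    rw [hQ a k i, ← sum_kron_mul (fun j => Q a i j * x i) k]
    exact Finset.sum_congr rfl fun j _ => by ring
  have e3 : ∑ i, A a i * kron k i = A a k := by
    rw [← sum_kron_mul (fun i => A a i) k]
    exact Finset.sum_congr rfl fun i _ => by ring
  rw [e1, e2, e3]
  ring

theorem pd_pd_quadMap (hQ : ∀ a i j, Q a i j = Q a j i) (x : E4) (k i a : Fin 4) :
    pd k (pd i (fun y => quadMap u₀ A Q y a)) x = - Q a i k := by
  have e : pd i (fun y => quadMap u₀ A Q y a) = fun x => A a i - ∑ j, Q a i j * x j :=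
    funext fun x => pd_quadMap hQ x i a
  have d : ∀ j, DifferentiableAt ℝ (fun y : E4 => y j) x := fun j => by fun_prop
  have d1 : DifferentiableAt ℝ (fun y : E4 => ∑ j, Q a i j * y j) x := by fun_prop
  rw [e, pd_sub (differentiableAt_const _) d1, pd_const, pd_sum fun j _ => (d j).const_mul _]
  simp only [pd_const_mul (d _), pd_coord]
  rw [← sum_kron_mul (fun j => Q a i j) k, zero_sub]
  congr 1
  exact Finset.sum_congr rfl fun j _ => by ring

theorem exists_hasFDerivAt_quadMap (hQ : ∀ a i j, Q a i j = Q a j i) (hA : IsUnit A.det) :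
    ∃ L : E4 ≃L[ℝ] E4, HasFDerivAt (quadMap u₀ A Q) (L : E4 →L[ℝ] E4) 0 := by
  have hd := (contDiff_quadMap (u₀ := u₀) (A := A) (Q := Q)).differentiable (by simp) 0
  set L := fderiv ℝ (quadMap u₀ A Q) 0 with hL
  have hLx : ∀ x : E4, (L x : E4).ofLp = A *ᵥ x.ofLp := by
    intro x
    funext a
    have h1 : (L x) a = fderiv ℝ (fun y => quadMap u₀ A Q y a) 0 x := by
      have h : fderiv ℝ (fun y => quadMap u₀ A Q y a) 0
          = (EuclideanSpace.proj (𝕜 := ℝ) a).comp L :=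
        ((EuclideanSpace.proj (𝕜 := ℝ) a).hasFDerivAt.comp 0 hd.hasFDerivAt).fderiv
      rw [h]
      rfl
    rw [h1, fderiv_eq_sum_pd, Matrix.mulVec, dotProduct]
    refine Finset.sum_congr rfl fun i _ => ?_
    rw [pd_quadMap hQ]
    simp [mul_comm]
  have hinj : Function.Injective (L : E4 →ₗ[ℝ] E4) := by
    rw [injective_iff_map_eq_zero]
    intro x hx
    have h2 : A *ᵥ x.ofLp = 0 := by
      rw [← hLx]
      exact congrArg WithLp.ofLp hx
    have h3 := Matrix.eq_zero_of_mulVec_eq_zero hA.ne_zero h2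
    ext i
    exact congrFun h3 i
  refine ⟨(LinearEquiv.ofInjectiveEndo (L : E4 →ₗ[ℝ] E4) hinj).toContinuousLinearEquiv, ?_⟩
  exact hd.hasFDerivAt.congr_fderiv (ContinuousLinearMap.ext fun x => rfl)

end QuadMap

/-- There is a change of coordinates `τ` with `τ 0 = u₀`, given by a quadratic map, for which the
transformed metric is the identity at `0` with vanishing first derivatives. -/
theorem exists_normal_map {G : E4 → Matrix (Fin 4) (Fin 4) ℝ} {u₀ : E4}
    (hG : ∀ i j, ContDiffAt ℝ ∞ (fun v => G v i j) u₀) (hs : ∀ v i j, G v i j = G v j i)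
    (hpos : (G u₀).PosDef) :
    ∃ τ : E4 → E4, ContDiff ℝ ∞ τ ∧ τ 0 = u₀ ∧
      (∃ L : E4 ≃L[ℝ] E4, HasFDerivAt τ (L : E4 →L[ℝ] E4) 0) ∧
      (∀ i j, ∑ a, ∑ b, pd i (fun y => τ y a) 0 * pd j (fun y => τ y b) 0 * G (τ 0) a b
        = kron i j) ∧
      ∀ k i j, pd k (fun x => ∑ a, ∑ b, pd i (fun y => τ y a) x * pd j (fun y => τ y b) x
        * G (τ x) a b) 0 = 0 := by
  obtain ⟨A, hA, hAG⟩ := exists_orthonormal_frame hpos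
  -- the derivatives of the metric in the coordinates given by `A` alone
  set P : Fin 4 → Fin 4 → Fin 4 → ℝ := fun k i j =>
    ∑ a, ∑ b, A a i * A b j * ∑ c, A c k * pd c (fun v => G v a b) u₀ with hP
  have hPs : ∀ k i j, P k i j = P k j i := by
    intro k i j
    simp only [hP]
    rw [Finset.sum_comm]
    refine Finset.sum_congr rfl fun a _ => Finset.sum_congr rfl fun b _ => ?_
    rw [show (fun v => G v b a) = fun v => G v a b from funext fun v => hs v b a]
    ring
  -- their Christoffel symbols are the second derivatives to be removed
  set K : Fin 4 → Fin 4 → Fin 4 → ℝ := fun l i k =>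
    (1 / 2) * (P i l k + P k l i - P l i k) with hK
  set Q : Fin 4 → Fin 4 → Fin 4 → ℝ := fun a i k => ∑ l, A a l * K l i k with hQ
  have hQs : ∀ a i j, Q a i j = Q a j i := by
    intro a i j
    refine Finset.sum_congr rfl fun l _ => ?_
    simp only [hK]
    rw [hPs l i j]
    ring
  have hAG' : ∀ i j, ∑ a, ∑ b, A a i * A b j * G u₀ a b = kron i j := by
    intro i j
    have h := congrFun (congrFun hAG i) j
    rw [Matrix.one_apply] at h
    rw [kron, ← h, Matrix.mul_apply]
    simp only [Matrix.mul_apply, Matrix.transpose_apply, Finset.sum_mul]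
    rw [Finset.sum_comm]
    exact Finset.sum_congr rfl fun a _ => Finset.sum_congr rfl fun b _ => by ring
  have hQK : ∀ i k j, ∑ a, ∑ b, Q a i k * A b j * G u₀ a b = K j i k := by
    intro i k j
    have e : ∀ a b, Q a i k * A b j * G u₀ a b = ∑ l, K l i k * (A a l * A b j * G u₀ a b) := by
      intro a b
      simp only [hQ, Finset.sum_mul]
      exact Finset.sum_congr rfl fun l _ => by ring
    simp only [e]
    calc ∑ a, ∑ b, ∑ l, K l i k * (A a l * A b j * G u₀ a b)
        = ∑ l, ∑ a, ∑ b, K l i k * (A a l * A b j * G u₀ a b) := by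
          simp only [Fin.sum_univ_four]; ring
      _ = ∑ l, kron j l * K l i k := by
          refine Finset.sum_congr rfl fun l _ => ?_
          simp only [← Finset.mul_sum, hAG']
          rw [kron_comm, mul_comm]
      _ = K j i k := sum_kron_mul _ _
  have hτ := contDiff_quadMap (u₀ := u₀) (A := A) (Q := Q)
  have hτ0 : quadMap u₀ A Q 0 = u₀ := quadMap_zero
  have hJ : ∀ i a, pd i (fun y => quadMap u₀ A Q y a) 0 = A a i := by
    intro i a
    rw [pd_quadMap hQs]
    simp
  refine ⟨quadMap u₀ A Q, hτ, hτ0, exists_hasFDerivAt_quadMap hQs hA, ?_, ?_⟩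
  · intro i j
    simp only [hJ, hτ0, hAG']
  · intro k i j
    have dτ : DifferentiableAt ℝ (quadMap u₀ A Q) 0 := hτ.differentiable (by simp) 0
    have dG : ∀ a b, DifferentiableAt ℝ (fun v => G v a b) (quadMap u₀ A Q 0) := fun a b => by
      rw [hτ0]; exact differentiableAt_of_contDiffAt (hG a b)
    have dGτ : ∀ a b, DifferentiableAt ℝ (fun x => G (quadMap u₀ A Q x) a b) 0 := fun a b =>
      (dG a b).comp (0 : E4) dτ
    have dJ : ∀ i a, DifferentiableAt ℝ (pd i (fun y => quadMap u₀ A Q y a)) 0 := fun i a => by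
      refine differentiableAt_of_contDiffAt (contDiffAt_pd ?_ i)
      exact (contDiff_piLp 2 |>.mp hτ a).contDiffAt
    have d : ∀ a b, DifferentiableAt ℝ (fun x => pd i (fun y => quadMap u₀ A Q y a) x
        * pd j (fun y => quadMap u₀ A Q y b) x * G (quadMap u₀ A Q x) a b) 0 := fun a b =>
      ((dJ i a).fun_mul (dJ j b)).fun_mul (dGτ a b)
    rw [pd_sum fun a _ => DifferentiableAt.fun_sum fun b _ => d a b]
    have e : ∀ a, pd k (fun x => ∑ b, pd i (fun y => quadMap u₀ A Q y a) x
        * pd j (fun y => quadMap u₀ A Q y b) x * G (quadMap u₀ A Q x) a b) 0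
        = ∑ b, (A a i * A b j * (∑ c, A c k * pd c (fun v => G v a b) u₀)
          - Q a i k * A b j * G u₀ a b - Q b j k * A a i * G u₀ b a) := by
      intro a
      rw [pd_sum fun b _ => d a b]
      refine Finset.sum_congr rfl fun b _ => ?_
      rw [pd_mul ((dJ i a).fun_mul (dJ j b)) (dGτ a b), pd_mul (dJ i a) (dJ j b),
        pd_comp (F := fun v => G v a b) dτ (dG a b), pd_pd_quadMap hQs, pd_pd_quadMap hQs,
        hs u₀ b a]
      simp only [hJ, hτ0]
      ring
    simp only [e, Finset.sum_sub_distrib, hQK]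
    rw [Finset.sum_comm (f := fun a b => Q b j k * A a i * G u₀ b a), hQK]
    change P k i j - _ - _ = 0
    simp only [hK]
    rw [hPs i j k, hPs k j i, hPs j i k]
    ring

/-! ### The squared gradient under changes of coordinates -/

theorem gradSq_eq_dotProduct (G : E4 → Matrix (Fin 4) (Fin 4) ℝ) (F : E4 → ℝ) (u : E4) :
    gradSq G F u = (fun a => pd a F u) ⬝ᵥ ((G u)⁻¹ *ᵥ fun a => pd a F u) := by
  simp only [gradSq, gInv, dotProduct, Matrix.mulVec, Finset.mul_sum]
  exact Finset.sum_congr rfl fun a _ => Finset.sum_congr rfl fun b _ => by ring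

theorem contDiffAt_gradSq {G : E4 → Matrix (Fin 4) (Fin 4) ℝ} {F : E4 → ℝ} {u : E4}
    (hG : ∀ i j, ContDiffAt ℝ ∞ (fun v => G v i j) u) (hdet : (G u).det ≠ 0)
    (hF : ContDiffAt ℝ ∞ F u) : ContDiffAt ℝ ∞ (gradSq G F) u := by
  have h1 := contDiffAt_gInv hG hdet
  have h2 := contDiffAt_pd hF
  unfold gradSq
  fun_prop

theorem gradSq_comp {G G' : E4 → Matrix (Fin 4) (Fin 4) ℝ} {F F' : E4 → ℝ} {x y : E4}
    {J : Matrix (Fin 4) (Fin 4) ℝ} (hG : ∀ i j, G' x i j = ∑ a, ∑ b, J a i * J b j * G y a b)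
    (hF : ∀ i, pd i F' x = ∑ a, J a i * pd a F y) (hdet : (G' x).det ≠ 0) :
    gradSq G' F' x = gradSq G F y := by
  have h1 : G' x = Jᵀ * G y * J := by
    ext i j
    rw [hG, Matrix.mul_apply]
    simp only [Matrix.mul_apply, Matrix.transpose_apply, Finset.sum_mul]
    rw [Finset.sum_comm]
    exact Finset.sum_congr rfl fun a _ => Finset.sum_congr rfl fun b _ => by ring
  have h2 : (fun i => pd i F' x) = Jᵀ *ᵥ fun a => pd a F y := by
    funext i
    rw [hF]
    rfl
  have hJ : IsUnit J.det := by
    rw [isUnit_iff_ne_zero]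
    rintro h0
    rw [h1, Matrix.det_mul, h0, mul_zero] at hdet
    exact hdet rfl
  rw [gradSq_eq_dotProduct, gradSq_eq_dotProduct, h1, h2, Matrix.mul_inv_rev, Matrix.mul_inv_rev,
    Matrix.mulVec_transpose, ← Matrix.dotProduct_mulVec, Matrix.mulVec_mulVec,
    ← Matrix.mulVec_transpose, Matrix.mulVec_mulVec, Matrix.mul_assoc, Matrix.mul_assoc,
    Matrix.mul_assoc, Matrix.nonsing_inv_mul _ (by simpa using hJ), Matrix.mul_one,
    ← Matrix.mul_assoc, Matrix.mul_nonsing_inv _ hJ, Matrix.one_mul]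

/-- Proportionality of differentials is independent of coordinates. -/
theorem pd_wedge_of_comp {N F : E4 → ℝ} {τ : E4 → E4} {x : E4} {L : E4 ≃L[ℝ] E4}
    (hτ : HasFDerivAt τ (L : E4 →L[ℝ] E4) x) (hN : DifferentiableAt ℝ N (τ x))
    (hF : DifferentiableAt ℝ F (τ x))
    (h : ∀ k l, pd k (fun y => N (τ y)) x * pd l (fun y => F (τ y)) x
      = pd l (fun y => N (τ y)) x * pd k (fun y => F (τ y)) x) (k l : Fin 4) :
    pd k N (τ x) * pd l F (τ x) = pd l N (τ x) * pd k F (τ x) := by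
  have hN' : fderiv ℝ (fun y => N (τ y)) x = (fderiv ℝ N (τ x)).comp (L : E4 →L[ℝ] E4) :=
    (hN.hasFDerivAt.comp x hτ).fderiv
  have hF' : fderiv ℝ (fun y => F (τ y)) x = (fderiv ℝ F (τ x)).comp (L : E4 →L[ℝ] E4) :=
    (hF.hasFDerivAt.comp x hτ).fderiv
  have hv : ∀ v w : E4, fderiv ℝ (fun y => N (τ y)) x v * fderiv ℝ (fun y => F (τ y)) x w
      = fderiv ℝ (fun y => N (τ y)) x w * fderiv ℝ (fun y => F (τ y)) x v := by
    intro v w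
    simp only [fderiv_eq_sum_pd, Finset.sum_mul_sum]
    rw [Finset.sum_comm]
    refine Finset.sum_congr rfl fun i _ => Finset.sum_congr rfl fun j _ => ?_
    linear_combination (v j * w i) * h j i
  have := hv (L.symm (EuclideanSpace.single k 1)) (L.symm (EuclideanSpace.single l 1))
  rw [hN', hF'] at this
  simpa [pd] using this

/-- On a soliton, if `d|∇F|²` is proportional to `dF`, then `∇F` is an eigenvector of the Ricci
tensor, because `∂_i |∇F|² = 2 (∇_i ∇_j F) ∇^j F` and `Ric = c g - ∇²F`. -/
theorem hasEigenvector_grad {G : E4 → Matrix (Fin 4) (Fin 4) ℝ} {F : E4 → ℝ} {u : E4} {c : ℝ}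
    (hG : ∀ i j, ContDiffAt ℝ ∞ (fun v => G v i j) u) (hdet : (G u).det ≠ 0)
    (hs : ∀ v i j, G v i j = G v j i) (hF : ContDiffAt ℝ ∞ F u)
    (hsol : ∀ i j, ric G i j u + hess G F i j u = c * G u i j)
    (h : ∀ k l, pd k (gradSq G F) u * pd l F u = pd l (gradSq G F) u * pd k F u)
    (h0 : grad G F u ≠ 0) :
    ∃ μ : ℝ, Module.End.HasEigenvector (ricEndo G u) μ (grad G F u) := by
  obtain ⟨l, hl⟩ : ∃ l, pd l F u ≠ 0 := by
    by_contra! hall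
    exact h0 (funext fun i => by simp [grad, hall])
  set ν := pd l (gradSq G F) u / pd l F u with hν
  have hN : ∀ k, pd k (gradSq G F) u = ν * pd k F u := by
    intro k
    rw [hν]
    field_simp
    linarith [h k l]
  have hlow : ∀ j, ∑ a, G u j a * grad G F u a = pd j F u := by
    intro j
    simp only [grad, Finset.mul_sum]
    rw [Finset.sum_comm]
    simp only [← mul_assoc, ← Finset.sum_mul, sum_mul_gInv hdet]
    simp
  have hric : ∀ j, ∑ k, ric G j k u * grad G F u k = (c - ν / 2) * pd j F u := by
    intro j
    have e1 := pd_gradSq hG hdet hs hF j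
    rw [hN] at e1
    have e2 : ∀ k, ric G j k u * grad G F u k
        = c * (G u j k * grad G F u k) - hess G F j k u * grad G F u k := fun k => by
      linear_combination grad G F u k * hsol j k
    simp only [e2, Finset.sum_sub_distrib, ← Finset.mul_sum, hlow]
    linarith
  refine ⟨c - ν / 2, Module.End.hasEigenvector_iff.mpr
    ⟨Module.End.mem_eigenspace_iff.mpr ?_, h0⟩⟩
  funext i
  rw [ricEndo, Matrix.toLin'_apply, Matrix.mulVec, dotProduct]
  simp only [Matrix.of_apply, Finset.sum_mul, Pi.smul_apply, smul_eq_mul]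
  rw [Finset.sum_comm]
  simp only [mul_assoc, ← Finset.mul_sum, hric]
  rw [grad, Finset.mul_sum]
  exact Finset.sum_congr rfl fun j _ => by ring

/-! ### The gradient of a half-harmonic soliton -/

/-- The sign of the coordinate frame is locally constant, being continuous with values in
`{-1, 0, 1}`. -/
theorem eventually_frameSign_eq {M : Type*} [TopologicalSpace M] [ChartedSpace E4 M]
    [IsManifold (𝓡 4) ∞ M] (o : ManifoldOrientation M) {φ : OpenPartialHomeomorph M E4}
    (hφ : φ ∈ IsManifold.maximalAtlas (𝓡 4) ∞ M) {u : E4} (hu : u ∈ φ.target) :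
    ∀ᶠ v in 𝓝 u, frameSign o.toFun φ v = frameSign o.toFun φ u := by
  have hc := (o.continuousOn_sign φ hφ).continuousAt (φ.open_target.mem_nhds hu)
  filter_upwards [hc (Metric.ball_mem_nhds _ one_pos)] with v hv
  have hv' : |frameSign o.toFun φ v - frameSign o.toFun φ u| < 1 := by
    simpa [Real.dist_eq] using hv
  rw [abs_lt] at hv'
  have h1 : ∀ w, frameSign o.toFun φ w = -1 ∨ frameSign o.toFun φ w = 0
      ∨ frameSign o.toFun φ w = 1 := fun w => Real.sign_apply_eq _
  rcases h1 v with h | h | h <;> rcases h1 u with h' | h' | h' <;> rw [h, h'] at hv' ⊢ <;>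
    norm_num at hv'

theorem exists_hasEigenvector_grad {M : Type*} [TopologicalSpace M] [ChartedSpace E4 M]
    [IsManifold (𝓡 4) ∞ M] {g : Metric M} {o : ManifoldOrientation M} {f : M → ℝ}
    (hf : IsGradientRicciSoliton g f) {σ : ℝ} (hσ : HarmonicHalfWeyl g o σ)
    {φ : OpenPartialHomeomorph M E4} (hφ : φ ∈ IsManifold.maximalAtlas (𝓡 4) ∞ M) {p : M}
    (hp : p ∈ φ.source) (hgrad : grad (g.coeff φ) (f ∘ φ.symm) (φ p) ≠ 0) :
    ∃ μ : ℝ, Module.End.HasEigenvector (ricEndo (g.coeff φ) (φ p)) μ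
      (grad (g.coeff φ) (f ∘ φ.symm) (φ p)) := by
  obtain ⟨hfs, c, hsol⟩ := hf
  have hF : ∀ ψ ∈ IsManifold.maximalAtlas (𝓡 4) ∞ M, ∀ u ∈ ψ.target,
      ContDiffAt ℝ ∞ (f ∘ ψ.symm) u := fun ψ hψ u hu =>
    contMDiffAt_iff_contDiffAt.mp
      ((hfs _).comp u (contMDiffAt_symm_of_mem_maximalAtlas hψ hu))
  have hu : φ p ∈ φ.target := φ.map_source hp
  have hG := contDiffAt_coeff g hφ hu
  have hdet := (posDef_coeff g hφ hu).det_pos.ne'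
  have hsymm := coeff_symm g φ
  refine hasEigenvector_grad hG hdet hsymm (hF φ hφ _ hu) (hsol φ hφ _ hu) ?_ hgrad
  obtain ⟨τ, hτ, hτ0, ⟨L, hL⟩, hkron, hpd⟩ :=
    exists_normal_map hG hsymm (posDef_coeff g hφ hu)
  obtain ⟨ψ, hψ, h0, hψτ⟩ := exists_chart_comp hφ hp hτ hτ0 hL
  have hnear : ∀ᶠ x in 𝓝 (0 : E4), x ∈ ψ.target := ψ.open_target.mem_nhds h0
  have hcoeff := fun x hx => coeff_comp g hφ hτ hψτ (x := x) hx
  have hnormal : IsNormalAt (g.coeff ψ) 0 :=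
    { contDiffAt := contDiffAt_coeff g hψ h0
      symm := coeff_symm g ψ
      eq_kron := fun i j => by rw [hcoeff 0 h0, hkron]
      pd_eq_zero := fun k i j => by
        rw [pd_congr (hnear.mono fun x hx => hcoeff x hx i j), hpd] }
  have key := hnormal.pd_gradSq_wedge (eventually_frameSign_eq o hψ h0) (hF ψ hψ 0 h0)
    (hnear.mono fun x hx => hsol ψ hψ x hx) (hσ ψ hψ 0 h0)
  have hFτ : ∀ x ∈ ψ.target, (f ∘ ψ.symm) x = (f ∘ φ.symm) (τ x) := fun x hx =>
    congrArg f (hψτ x hx).2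
  have hFτ' : ∀ x ∈ ψ.target, (f ∘ ψ.symm) =ᶠ[𝓝 x] fun y => (f ∘ φ.symm) (τ y) := fun x hx =>
    Filter.mem_of_superset (ψ.open_target.mem_nhds hx) hFτ
  have hNτ : gradSq (g.coeff ψ) (f ∘ ψ.symm)
      =ᶠ[𝓝 0] fun y => gradSq (g.coeff φ) (f ∘ φ.symm) (τ y) := by
    filter_upwards [hnear] with x hx
    refine gradSq_comp (J := Matrix.of fun a i => pd i (fun y => τ y a) x)
      (hcoeff x hx) (fun i => ?_) (posDef_coeff g hψ hx).det_pos.ne'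
    rw [pd_congr (hFτ' x hx)]
    exact pd_comp (hτ.differentiable (by simp) x)
      (differentiableAt_of_contDiffAt (hF φ hφ _ (hψτ x hx).1)) i
  simp only [pd_congr hNτ, pd_congr (hFτ' 0 h0)] at key
  rw [← hτ0] at hu hG hdet ⊢
  exact pd_wedge_of_comp hL
    (differentiableAt_of_contDiffAt
      (contDiffAt_gradSq hG hdet (hF φ hφ _ hu)))
    (differentiableAt_of_contDiffAt (hF φ hφ _ hu)) key

end HalfWeyl

theorem lemma2p4 {M : Type*} [TopologicalSpace M] [ChartedSpace HalfWeyl.E4 M]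
    [IsManifold (𝓡 4) ∞ M] (g : HalfWeyl.Metric M) (o : HalfWeyl.ManifoldOrientation M)
    (f : M → ℝ) (hf : HalfWeyl.IsGradientRicciSoliton g f)
    (hW : HalfWeyl.HarmonicHalfWeyl g o 1 ∨ HalfWeyl.HarmonicHalfWeyl g o (-1)) :
    ∀ φ ∈ IsManifold.maximalAtlas (𝓡 4) ∞ M, ∀ p ∈ φ.source,
      HalfWeyl.grad (g.coeff φ) (f ∘ φ.symm) (φ p) ≠ 0 →
      ∃ μ : ℝ, Module.End.HasEigenvector (HalfWeyl.ricEndo (g.coeff φ) (φ p)) μ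
        (HalfWeyl.grad (g.coeff φ) (f ∘ φ.symm) (φ p)) := by
  intro φ hφ p hp hgrad
  rcases hW with hW | hW <;> exact HalfWeyl.exists_hasEigenvector_grad hf hW hφ hp hgrad

end
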